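/- **Setting.** Let $\mathcal A$ be a set of external actions, $\tau\notin\mathcal A$ and $Act=\mathcal A\cup\{\tau\}$. The terms of finite state randomized CCS are $$T ::= \mathbf 0 \mid X \mid \sum_{i\in I}\alpha_i.T_i \mid \bigoplus_{i\in I}p_i\tau.T_i\mid \mu X.T ,$$ with $I$ finite and non-empty and $\alpha_i\in Act$; in $\bigoplus$ moreover $|I|\ge 2$, $p_i\in(0,1)$ and $\sum_i p_i=1$; in $\mu X.T$ every free occurrence of $X$ in $T$ lies inside some $\sum$ or $\bigoplus$. Processes are the terms without free variables; $\mathcal P$ is the set of processes. Transitions are generated by $\sum_i\alpha_i.T_i\xrightarrow{\alpha_i}T_i$, $\bigoplus_i p_i\tau.T_i\xrightarrow{p_i\tau}T_i$, and $\mu X.T\xrightarrow{\lambda}T'$ whenever $T\{\mu X.T/X\}\xrightarrow{\lambda}T'$. Collective silent transitions are generated by $\bigoplus_{i\in I} p_i\tau.T_i\xrightarrow{\coprod_{i}p_i\tau}\coprod_{i}T_i$ and the same rule for $\mu X.T$. Labels $\tau$ and $p\tau$ are called silent. Let $\mathcal E$ be an equivalence on $\mathcal P$. An *$\epsilon$-tree*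 of $A$ w.r.t. $\mathcal E$ is a finitely branching rooted tree with nodes labelled in $[A]_{\mathcal E}$, root labelled $A$, and edges labelled in $(0,1]$, such that a node labelled $B$ with exactly one child $B'$ satisfies $B\xrightarrow{\tau}B'$ with edge label $1$, and a node labelled $B$ with $k\ge2$ children $B_1,\dots,B_k$ and edge labels $p_1,\dots,p_k$ satisfies $B\xrightarrow{\coprod_i p_i\tau}\coprod_i B_i$. Let $\mathsf P_k(t)$ be the sum, over all leaves of $t$ at depth at most $k$, of the product of the edge labels on the path from the root; $t$ is *regular* if $\lim_k\mathsf P_k(t)=1$ and *divergent* if $\lim_k\mathsf P_k(t)=0$. For $\mathcal C\in\mathcal P/\mathcal E$ and $\ell\in Act$ with $\ell\in\mathcal A$, or $\ell=\tau$ and $\mathcal C\ne[A]_{\mathcal E}$, write $A\rightsquigarrow_{\mathcal E}\xrightarrow{\ell}\mathcal C$ if $A$ has a regular $\epsilon$-tree each of whose leaves $L$ has a transition $L\xrightarrow{\ell}L'$ with $L'\in\mathcal C$. For $\mathcal C\neq[A]_{\mathcal E}$ and $q\in\mathbb R$ write $A\rightsquigarrow_{\mathcal E}\xrightarrow{q}\mathcal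 C$ if $A$ has a regular $\epsilon$-tree each of whose leaves $L$ has a collective silent transition $L\xrightarrow{\coprod_i p_i\tau}\coprod_i L_i$ with $\sum_{L_i\in[L]_{\mathcal E}}p_i<1$ and $\bigl(\sum_{L_i\in\mathcal C}p_i\bigr)/\bigl(1-\sum_{L_i\in[L]_{\mathcal E}}p_i\bigr)=q$. $\mathcal E$ is a *branching bisimulation* if for all $(A,B)\in\mathcal E$ and all $\mathcal C\in\mathcal P/\mathcal E$, each such transition $A\rightsquigarrow_{\mathcal E}\xrightarrow{\ell}\mathcal C$ or $A\rightsquigarrow_{\mathcal E}\xrightarrow{q}\mathcal C$ is also possible for $B$ (with the same $\ell$ or $q$ and the same $\mathcal C$). It is a *branching bisimulation with explicit divergence* if in addition, for all $(A,B)\in\mathcal E$, $A$ has a divergent $\epsilon$-tree w.r.t. $\mathcal E$ if and only if $B$ has one. Write $A\simeq^{\Delta}B$ if some branching bisimulation with explicit divergence contains $(A,B)$. A *$\tau$-EC* of a process $B$ is a strongly connected subgraph $(V,E)$, with at least one edge, of the labelled transition graph of the processes reachable from $B$, all of whose edges have silent labels, and such that for every edge $(C,q\tau,C')\in E$ with $q\in(0,1)$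 there is a collective silent transition $C\xrightarrow{\coprod_i p_i\tau}\coprod_i C_i$ with $q=p_k$ and $C'=C_k$ for some $k$, and with $(C,p_i\tau,C_i)\in E$ for all $i$. Write $A\Rightarrow\circlearrowleft_{\mathsf{ec}}$ if some node of the $\tau$-EC $\mathsf{ec}$ is reachable from $A$ by silent transitions. For a relation $\mathcal R$ on $\mathcal P$ write $\mathsf{ec}_1\,\mathcal R^{\ddagger}\,\mathsf{ec}_2$ if for each node $B$ of $\mathsf{ec}_2$ there is a node $A$ of $\mathsf{ec}_1$ with $(A,B)\in\mathcal R$. $\mathcal R$ is *$\tau$-EC invariant* if for all $(A,B)\in\mathcal R$: whenever $A\Rightarrow\circlearrowleft_{\mathsf{ec}_1}$, then $B\Rightarrow\circlearrowleft_{\mathsf{ec}_2}$ for some $\mathsf{ec}_2$ with $\mathsf{ec}_1\,\mathcal R^{\ddagger}\,\mathsf{ec}_2$; and whenever $B\Rightarrow\circlearrowleft_{\mathsf{ec}_2}$, then $A\Rightarrow\circlearrowleft_{\mathsf{ec}_1}$ for some $\mathsf{ec}_1$ with $\mathsf{ec}_2\,(\mathcal R^{-1})^{\ddagger}\,\mathsf{ec}_1$.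 An *exhaustive branching bisimulation* is a $\tau$-EC invariant branching bisimulation; $A\simeq_e B$ means that some exhaustive branching bisimulation contains $(A,B)$. **Theorem.** The relation $\simeq^{\Delta}$ is $\tau$-EC invariant. It is an equivalence and an exhaustive branching bisimulation, and hence ${\simeq^{\Delta}}\subseteq{\simeq_e}$. -/

import Mathlib

open Filter Topology

noncomputable section

namespace RCCS

/-! ### Syntax of finite state randomized CCS -/

/-- Actions: the external actions `a : 𝒜`, and the internal action `τ`. -/
inductive Act (𝒜 : Type*) where
  | ext (a : 𝒜) : Act 𝒜
  | tau : Act 𝒜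

/-- Transition labels: an action, or `pτ` for a probability `p`. (Only `0 < p < 1` ever occurs on a
transition of a process.) -/
inductive Label (𝒜 : Type*) where
  | act (α : Act 𝒜) : Label 𝒜
  | prob (p : ℝ) : Label 𝒜

/-- Raw terms `0 | X | ∑ αᵢ.Tᵢ | ⨁ pᵢτ.Tᵢ | μX.T`; process variables are natural numbers and the
finite index sets are the sets `Fin n`. -/
inductive Term (𝒜 : Type*) where
  | nil : Term 𝒜
  | var (X : ℕ) : Term 𝒜
  | sum (n : ℕ) (α : Fin n → Act 𝒜) (T : Fin n → Term 𝒜) : Term 𝒜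
  | choice (n : ℕ) (p : Fin n → ℝ) (T : Fin n → Term 𝒜) : Term 𝒜
  | fix (X : ℕ) (T : Term 𝒜) : Term 𝒜

namespace Term

variable {𝒜 : Type*}

/-- `T.Free X`: the variable `X` occurs free in `T`. -/
def Free : Term 𝒜 → ℕ → Prop
  | nil, _ => False
  | var Y, X => Y = X
  | sum _ _ T, X => ∃ i, (T i).Free X
  | choice _ _ T, X => ∃ i, (T i).Free X
  | fix Y T, X => X ≠ Y ∧ T.Free X

/-- `T.Guarded X`: every free occurrence of `X` in `T` lies inside a nondeterministic or a
probabilistic choice. -/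
def Guarded : Term 𝒜 → ℕ → Prop
  | nil, _ => True
  | var Y, X => Y ≠ X
  | sum _ _ _, _ => True
  | choice _ _ _, _ => True
  | fix Y T, X => Y = X ∨ T.Guarded X

/-- The side conditions of the grammar: choices are over non-empty index sets, probabilistic choices
have at least two branches, with probabilities in `(0,1)` that sum to one, and variables bound by a
fixpoint are guarded. -/
def WellFormed : Term 𝒜 → Prop
  | nil => True
  | var _ => True
  | sum n _ T => 0 < n ∧ ∀ i, (T i).WellFormed
  | choice n p T =>
      2 ≤ n ∧ (∀ i, 0 < p i ∧ p i < 1) ∧ ∑ i, p i = 1 ∧ ∀ i, (T i).WellFormed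
  | fix X T => T.Guarded X ∧ T.WellFormed

/-- `subst X S T` is `T{S/X}`. It is only used for terms `S` without free variables (unfolding a
fixpoint process), so that no variable capture can occur. -/
def subst (X : ℕ) (S : Term 𝒜) : Term 𝒜 → Term 𝒜
  | nil => nil
  | var Y => if Y = X then S else var Y
  | sum n α T => sum n α fun i => subst X S (T i)
  | choice n p T => choice n p fun i => subst X S (T i)
  | fix Y T => if Y = X then fix Y T else fix Y (subst X S T)

/-- The labelled transition relation `T —λ→ T'`. -/
inductive Step : Term 𝒜 → Label 𝒜 → Term 𝒜 → Prop
  | sum {n : ℕ} (α : Fin n → Act 𝒜) (T : Fin n → Term 𝒜) (i : Fin n) :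
      Step (.sum n α T) (.act (α i)) (T i)
  | choice {n : ℕ} (p : Fin n → ℝ) (T : Fin n → Term 𝒜) (i : Fin n) :
      Step (.choice n p T) (.prob (p i)) (T i)
  | fix {X : ℕ} {T T' : Term 𝒜} {l : Label 𝒜} :
      Step (subst X (.fix X T) T) l T' → Step (.fix X T) l T'

/-- The collective silent transition `T —∐ pᵢτ→ ∐ Tᵢ`, with `i` ranging over `Fin k`. -/
inductive Collective : Term 𝒜 → (k : ℕ) → (Fin k → ℝ) → (Fin k → Term 𝒜) → Prop
  | choice {n : ℕ} (p : Fin n → ℝ) (T : Fin n → Term 𝒜) : Collective (.choice n p T) n p T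
  | fix {X : ℕ} {T : Term 𝒜} {k : ℕ} {p : Fin k → ℝ} {U : Fin k → Term 𝒜} :
      Collective (subst X (.fix X T) T) k p U → Collective (.fix X T) k p U

end Term

/-- The set of processes: well-formed terms without free variables. -/
def Proc (𝒜 : Type*) : Type _ :=
  {T : Term 𝒜 // T.WellFormed ∧ ∀ X, ¬ T.Free X}

variable {𝒜 : Type*}

/-- `A —λ→ B` for processes. -/
def Step (A : Proc 𝒜) (l : Label 𝒜) (B : Proc 𝒜) : Prop :=
  Term.Step A.1 l B.1

/-- `A —∐ pᵢτ→ ∐ Bᵢ` for processes. -/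
def Collective (A : Proc 𝒜) (k : ℕ) (p : Fin k → ℝ) (B : Fin k → Proc 𝒜) : Prop :=
  Term.Collective A.1 k p fun i => (B i).1

/-! ### Labelled trees -/

/-- Finitely branching rooted trees with nodes labelled in `S` and edges labelled by real numbers.
A node is addressed by the list of the child numbers on the way from the node *up to* the root:
the root is `[]`, and the children of `v` are `i :: v` for `i < arity v`. The edge from `v` to
`i :: v` has the label `weight (i :: v)`. Values at lists which are not nodes are irrelevant. -/
structure LTree (S : Type*) where
  arity : List ℕ → ℕ
  label : List ℕ → S
  weight : List ℕ → ℝ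

namespace LTree

variable {S : Type*} (t : LTree S)

/-- The addresses that are nodes of the tree. -/
inductive IsNode : List ℕ → Prop
  | root : IsNode []
  | child {v : List ℕ} {i : ℕ} : IsNode v → i < t.arity v → IsNode (i :: v)

/-- Leaves: nodes without children. They correspond to the finite branches of the tree, and the
length of the branch is the length of the address. -/
def IsLeaf (v : List ℕ) : Prop := t.IsNode v ∧ t.arity v = 0

/-- The probability of the path from the root to `v`: the product of its edge labels. -/
def pathProb : List ℕ → ℝ
  | [] => 1
  | i :: v => pathProb v * t.weight (i :: v)

theorem finite_nodes (k : ℕ) : {v | t.IsNode v ∧ v.length ≤ k}.Finite := by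
  induction k with
  | zero =>
    refine (Set.finite_singleton ([] : List ℕ)).subset ?_
    rintro v ⟨-, hv⟩
    simpa using hv
  | succ k ih =>
    refine ((Set.finite_singleton ([] : List ℕ)).union
      (ih.biUnion fun v _ => (Set.finite_Iio (t.arity v)).image fun i => i :: v)).subset ?_
    rintro v ⟨hv, hl⟩
    cases hv with
    | root => exact Or.inl rfl
    | @child w i hw hi =>
      refine Or.inr (Set.mem_biUnion (x := w) ⟨hw, ?_⟩ ⟨i, hi, rfl⟩)
      simpa using hl

theorem finite_leaves (k : ℕ) : {v | t.IsLeaf v ∧ v.length ≤ k}.Finite :=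
  (t.finite_nodes k).subset fun _ hv => ⟨hv.1.1, hv.2⟩

/-- The total probability of the finite branches of length at most `k`. -/
def probUpTo (k : ℕ) : ℝ := ∑ v ∈ (t.finite_leaves k).toFinset, t.pathProb v

/-- Convergence probability one. -/
def Regular : Prop := Tendsto t.probUpTo atTop (𝓝 1)

/-- Convergence probability zero. -/
def Divergent : Prop := Tendsto t.probUpTo atTop (𝓝 0)

end LTree

/-! ### Branching bisimulation -/

/-- `t` is an `ε`-tree of `A` with regard to `E`. -/
structure IsEpsTree (E : Proc 𝒜 → Proc 𝒜 → Prop) (A : Proc 𝒜)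
    (t : LTree (Proc 𝒜)) : Prop where
  root : t.label [] = A
  mem_class : ∀ v, t.IsNode v → E A (t.label v)
  weight_mem : ∀ v, t.IsNode v → ∀ i, i < t.arity v → t.weight (i :: v) ∈ Set.Ioc (0 : ℝ) 1
  one_child : ∀ v, t.IsNode v → t.arity v = 1 →
    Step (t.label v) (.act .tau) (t.label (0 :: v)) ∧ t.weight (0 :: v) = 1
  children : ∀ v, t.IsNode v → 2 ≤ t.arity v →
    Collective (t.label v) (t.arity v) (fun i => t.weight (i.1 :: v)) (fun i => t.label (i.1 :: v))

/-- The class `[A]_E`. -/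
def cls (E : Proc 𝒜 → Proc 𝒜 → Prop) (A : Proc 𝒜) : Set (Proc 𝒜) := {B | E A B}

/-- The set of all classes of `E`. -/
def classes (E : Proc 𝒜 → Proc 𝒜 → Prop) : Set (Set (Proc 𝒜)) := Set.range (cls E)

/-- The `ℓ`-transition `A ⇝_E —ℓ→ C` to a class `C` of `E`, where `ℓ` is external, or `ℓ = τ` and
`C ≠ [A]_E`. -/
def EllTrans (E : Proc 𝒜 → Proc 𝒜 → Prop) (A : Proc 𝒜) (l : Act 𝒜)
    (C : Set (Proc 𝒜)) : Prop :=
  C ∈ classes E ∧ ((∃ a, l = .ext a) ∨ (l = .tau ∧ C ≠ cls E A)) ∧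
    ∃ t : LTree (Proc 𝒜), IsEpsTree E A t ∧ t.Regular ∧
      ∀ v, t.IsLeaf v → ∃ L' ∈ C, Step (t.label v) (.act l) L'

open Classical in
/-- The probability that the collective silent transition with probabilities `p` and targets `B`
arrives in `C`. -/
def arrive {k : ℕ} (p : Fin k → ℝ) (B : Fin k → Proc 𝒜) (C : Set (Proc 𝒜)) : ℝ :=
  ∑ i, if B i ∈ C then p i else 0

/-- The `q`-transition `A ⇝_E —q→ C` to a class `C ≠ [A]_E`: at every leaf `L` of some regular
`ε`-tree there is a collective silent transition that leaves `[L]_E` with positive probability and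
whose normalized probability of arriving in `C` is `q`. -/
def QTrans (E : Proc 𝒜 → Proc 𝒜 → Prop) (A : Proc 𝒜) (q : ℝ)
    (C : Set (Proc 𝒜)) : Prop :=
  C ∈ classes E ∧ C ≠ cls E A ∧
    ∃ t : LTree (Proc 𝒜), IsEpsTree E A t ∧ t.Regular ∧
      ∀ v, t.IsLeaf v → ∃ (k : ℕ) (p : Fin k → ℝ) (B : Fin k → Proc 𝒜),
        Collective (t.label v) k p B ∧ arrive p B (cls E (t.label v)) < 1 ∧
        arrive p B C / (1 - arrive p B (cls E (t.label v))) = q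

/-- Branching bisimulations. (The side conditions on `l` and `C` are part of `EllTrans` and
`QTrans`.) -/
structure IsBranchingBisim (E : Proc 𝒜 → Proc 𝒜 → Prop) : Prop where
  equiv : Equivalence E
  ell : ∀ A B, E A B → ∀ C ∈ classes E, ∀ l, EllTrans E A l C → EllTrans E B l C
  q : ∀ A B, E A B → ∀ C ∈ classes E, ∀ q, QTrans E A q C → QTrans E B q C

/-! ### Branching bisimilarity with explicit divergence -/

/-- `A ⇑_E`: there is a divergent `ε`-tree of `A` with regard to `E`. -/
def Diverges (E : Proc 𝒜 → Proc 𝒜 → Prop) (A : Proc 𝒜) : Prop :=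
  ∃ t : LTree (Proc 𝒜), IsEpsTree E A t ∧ t.Divergent

/-- Divergent `ε`-tree preserving relations. -/
def DivTreePreserving (E : Proc 𝒜 → Proc 𝒜 → Prop) : Prop :=
  ∀ A B, E A B → (Diverges E A ↔ Diverges E B)

/-- Branching bisimulations with explicit divergence. -/
def IsBranchingBisimED (E : Proc 𝒜 → Proc 𝒜 → Prop) : Prop :=
  IsBranchingBisim E ∧ DivTreePreserving E

/-- Branching bisimilarity with explicit divergence `≃^Δ`. -/
def BisimilarED (A B : Proc 𝒜) : Prop :=
  ∃ E : Proc 𝒜 → Proc 𝒜 → Prop, IsBranchingBisimED E ∧ E A B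

/-! ### Exhaustive branching bisimilarity -/

/-- The silent labels `τ` and `pτ` with `0 < p < 1`. -/
def IsSilent (l : Label 𝒜) : Prop :=
  l = .act .tau ∨ ∃ p : ℝ, 0 < p ∧ p < 1 ∧ l = .prob p

/-- `B` is reachable from `A` (by transitions with arbitrary labels). -/
def Reachable : Proc 𝒜 → Proc 𝒜 → Prop :=
  Relation.ReflTransGen fun C D => ∃ l, Step C l D

/-- `A ⇒ B`: `B` is reachable from `A` by transitions labelled `τ` or `pτ`. -/
def SilentReach : Proc 𝒜 → Proc 𝒜 → Prop :=
  Relation.ReflTransGen fun C D => ∃ l, IsSilent l ∧ Step C l D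

/-- A directed graph on processes with labelled edges `(C, λ, D)`. -/
structure Graph (𝒜 : Type*) where
  verts : Set (Proc 𝒜)
  edges : Set (Proc 𝒜 × Label 𝒜 × Proc 𝒜)

/-- `G` is a `τ`-end component of `B`: a strongly connected subgraph, with at least one edge, of the
induced transition graph of `B`, all of whose edges are silent, and which with one branch of a
probabilistic choice contains all branches of this choice. -/
structure IsTauECOf (B : Proc 𝒜) (G : Graph 𝒜) : Prop where
  reach : ∀ C ∈ G.verts, Reachable B C
  edge : ∀ C l D, (C, l, D) ∈ G.edges → C ∈ G.verts ∧ D ∈ G.verts ∧ Step C l D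
  nonempty : G.edges.Nonempty
  connected : ∀ C ∈ G.verts, ∀ D ∈ G.verts,
    Relation.ReflTransGen (fun C' D' => ∃ l, (C', l, D') ∈ G.edges) C D
  silent : ∀ C l D, (C, l, D) ∈ G.edges → IsSilent l
  closed : ∀ C r C', (C, Label.prob r, C') ∈ G.edges →
    ∃ (n : ℕ) (p : Fin n → ℝ) (D : Fin n → Proc 𝒜), Collective C n p D ∧
      (∃ k, r = p k ∧ C' = D k) ∧ ∀ i, (C, Label.prob (p i), D i) ∈ G.edges

/-- `G` is a `τ`-end component (of some process). -/
def IsTauEC (G : Graph 𝒜) : Prop := ∃ B, IsTauECOf B G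

/-- `A ⇒ ↻_G`: some process in `G` is silently reachable from `A`. -/
def ReachesEC (A : Proc 𝒜) (G : Graph 𝒜) : Prop :=
  ∃ A', SilentReach A A' ∧ A' ∈ G.verts

/-- `G₁ R^‡ G₂`: every node of `G₂` is related to some node of `G₁`. -/
def RelatedEC (R : Proc 𝒜 → Proc 𝒜 → Prop) (G₁ G₂ : Graph 𝒜) : Prop :=
  ∀ B ∈ G₂.verts, ∃ A ∈ G₁.verts, R A B

/-- `τ`-EC invariant relations. -/
def TauECInvariant (R : Proc 𝒜 → Proc 𝒜 → Prop) : Prop :=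
  ∀ A B, R A B →
    (∀ G₁, IsTauEC G₁ → ReachesEC A G₁ →
      ∃ G₂, IsTauEC G₂ ∧ ReachesEC B G₂ ∧ RelatedEC R G₁ G₂) ∧
    (∀ G₂, IsTauEC G₂ → ReachesEC B G₂ →
      ∃ G₁, IsTauEC G₁ ∧ ReachesEC A G₁ ∧ RelatedEC (fun C D => R D C) G₂ G₁)

/-- Exhaustive branching bisimulations. -/
def IsExhaustiveBranchingBisim (E : Proc 𝒜 → Proc 𝒜 → Prop) : Prop :=
  IsBranchingBisim E ∧ TauECInvariant E

/-- Exhaustive branching bisimilarity `≃_e`. -/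
def ExhaustiveBisimilar (A B : Proc 𝒜) : Prop :=
  ∃ E : Proc 𝒜 → Proc 𝒜 → Prop, IsExhaustiveBranchingBisim E ∧ E A B

end RCCS

end

open Filter Topology

noncomputable section

namespace RCCS

namespace Term

variable {𝒜 : Type*}

/-! ### Operational semantics of raw terms -/

/-! Trees are eliminated first. Only finitely many processes are reachable from a given one
(`finite_reachable`), so almost sure arrival is a question of graphs: `A` has a regular `ε`-tree
with all leaves in `P` iff some `W ⊆ [A]`, with `A ∈ W`, is such that every member can reach `P` by
moves all of whose branches lie in `W` (`AlmostSure`). Likewise `A` has a divergent `ε`-tree iff it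
lies in some `W ⊆ [A]` each of whose members has a move with all branches in `W` (`CanStay`).

A branching bisimulation `F` then simulates single moves (`IsBranchingBisim.transfer_move`). If `F M
N` and a move of `M` has a branch outside `[M]`, then `N` reaches, inside its class, a process with
a move whose branches are all related to `M` or to branches of the given move, the chosen exit being
matched. This rests on determinism: a process with a collective silent transition has only this one
and no action transitions, so matching one exit forces all normalized exit probabilities to agree.

Consequently conditions expressed by a set `W` pass to its `F`-saturation. For weak transitions and
divergence with regard to an equivalence `E` coarser than `F`, this shows that they are invariant
along `F`. With `E` the transitive closure of `≃^Δ`, each link of a chain lies in some such `F`, so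
`E` is a branching bisimulation with explicit divergence and equals `≃^Δ`.

For invariance of end components, every node of a `τ`-EC can stay in its node set `V`. Explicit
divergence makes the saturation of `V` inherit this property
(`IsBranchingBisimED.canStay_saturation`). A bottom strongly connected component of the moves
staying in the saturation is again a `τ`-EC (`exists_tauEC`), and all its nodes are related to nodes
of the original one. -/

theorem Collective.unique {T : Term 𝒜} {k : ℕ} {p : Fin k → ℝ} {U : Fin k → Term 𝒜}
    (h : Collective T k p U) : ∀ {k' : ℕ} {p' : Fin k' → ℝ} {U' : Fin k' → Term 𝒜},
    Collective T k' p' U' →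
    (⟨k, p, U⟩ : Σ k, (Fin k → ℝ) × (Fin k → Term 𝒜)) = ⟨k', p', U'⟩ := by
  induction h with
  | choice p T => intro k' p' U' h'; cases h'; rfl
  | fix _ ih => intro k' p' U' h'; cases h' with | fix h' => exact ih h'

theorem Collective.not_step_act {T : Term 𝒜} {k : ℕ} {p : Fin k → ℝ} {U : Fin k → Term 𝒜}
    (h : Collective T k p U) : ∀ {a : Act 𝒜} {T' : Term 𝒜}, ¬ Step T (.act a) T' := by
  induction h with
  | choice p T => intro a T' h'; cases h'
  | fix _ ih => intro a T' h'; cases h' with | fix h' => exact ih h'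

theorem Collective.step {T : Term 𝒜} {k : ℕ} {p : Fin k → ℝ} {U : Fin k → Term 𝒜}
    (h : Collective T k p U) (i : Fin k) : Step T (.prob (p i)) (U i) := by
  induction h with
  | choice p T => exact .choice p T i
  | fix _ ih => exact .fix (ih i)

theorem Step.exists_collective {T T' : Term 𝒜} {l : Label 𝒜} (h : Step T l T') :
    ∀ {r : ℝ}, l = .prob r →
      ∃ (k : ℕ) (p : Fin k → ℝ) (U : Fin k → Term 𝒜) (i : Fin k),
        Collective T k p U ∧ p i = r ∧ U i = T' := by
  induction h with
  | sum α T i => intro r h; cases h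
  | choice p T i => intro r h; cases h; exact ⟨_, p, T, i, .choice p T, rfl, rfl⟩
  | fix _ ih =>
    intro r h
    obtain ⟨k, p, U, i, hc, h1, h2⟩ := ih h
    exact ⟨k, p, U, i, .fix hc, h1, h2⟩

/-- Terms without free variables. -/
def Closed (T : Term 𝒜) : Prop := ∀ X, ¬ T.Free X

theorem Guarded.of_not_free {T : Term 𝒜} {X : ℕ} (h : ¬ T.Free X) : T.Guarded X := by
  induction T with
  | nil => trivial
  | var Y => exact h
  | sum n α T ih => trivial
  | choice n p T ih => trivial
  | fix Y T ih =>
    by_cases hY : Y = X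
    · exact .inl hY
    · exact .inr (ih fun hf => h ⟨fun e => hY e.symm, hf⟩)

theorem free_of_free_subst {X Y : ℕ} {S T : Term 𝒜} (hS : S.Closed) (h : (subst X S T).Free Y) :
    T.Free Y ∧ Y ≠ X := by
  induction T with
  | nil => exact h.elim
  | var Z =>
    by_cases hZ : Z = X
    · simp only [subst, hZ, if_true] at h
      exact (hS Y h).elim
    · simp only [subst, hZ, if_false] at h
      refine ⟨h, ?_⟩
      rintro rfl
      exact hZ h
  | sum n α T ih => obtain ⟨i, hi⟩ := h; exact ⟨⟨i, (ih i hi).1⟩, (ih i hi).2⟩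
  | choice n p T ih => obtain ⟨i, hi⟩ := h; exact ⟨⟨i, (ih i hi).1⟩, (ih i hi).2⟩
  | fix Z T ih =>
    by_cases hZ : Z = X
    · simp only [subst, hZ, if_true] at h
      subst hZ
      exact ⟨h, h.1⟩
    · simp only [subst, hZ, if_false] at h
      exact ⟨⟨h.1, (ih h.2).1⟩, (ih h.2).2⟩

theorem Guarded.subst {X Y : ℕ} {S T : Term 𝒜} (hS : S.Closed) (h : T.Guarded Y) :
    (subst X S T).Guarded Y := by
  induction T with
  | nil => trivial
  | var Z =>
    by_cases hZ : Z = X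
    · simp only [Term.subst, hZ, if_true]
      exact .of_not_free (hS Y)
    · simpa only [Term.subst, hZ, if_false] using h
  | sum n α T ih => trivial
  | choice n p T ih => trivial
  | fix Z T ih =>
    by_cases hZ : Z = X
    · simpa only [Term.subst, hZ, if_true] using h
    · simp only [Term.subst, hZ, if_false]
      exact h.imp id ih

theorem WellFormed.subst {X : ℕ} {S T : Term 𝒜} (hS : S.Closed) (hS' : S.WellFormed)
    (h : T.WellFormed) : (subst X S T).WellFormed := by
  induction T with
  | nil => trivial
  | var Z =>
    by_cases hZ : Z = X
    · simpa only [Term.subst, hZ, if_true] using hS'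
    · simpa only [Term.subst, hZ, if_false] using h
  | sum n α T ih => exact ⟨h.1, fun i => ih i (h.2 i)⟩
  | choice n p T ih => exact ⟨h.1, h.2.1, h.2.2.1, fun i => ih i (h.2.2.2 i)⟩
  | fix Z T ih =>
    by_cases hZ : Z = X
    · simpa only [Term.subst, hZ, if_true] using h
    · simp only [Term.subst, hZ, if_false]
      exact ⟨h.1.subst hS, ih h.2⟩

/-- Processes: the well-formed closed terms. -/
def IsProc (T : Term 𝒜) : Prop := T.WellFormed ∧ T.Closed

theorem IsProc.unfold {X : ℕ} {T : Term 𝒜} (h : (fix X T).IsProc) :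
    (subst X (fix X T) T).IsProc := by
  refine ⟨.subst h.2 h.1 h.1.2, fun Y hY => ?_⟩
  obtain ⟨h1, h2⟩ := free_of_free_subst h.2 hY
  exact h.2 Y ⟨h2, h1⟩

theorem Step.isProc {T T' : Term 𝒜} {l : Label 𝒜} (h : Step T l T') (hT : T.IsProc) :
    T'.IsProc := by
  induction h with
  | sum α T i => exact ⟨hT.1.2 i, fun X hX => hT.2 X ⟨i, hX⟩⟩
  | choice p T i => exact ⟨hT.1.2.2.2 i, fun X hX => hT.2 X ⟨i, hX⟩⟩
  | fix _ ih => exact ih hT.unfold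

theorem Collective.probs {T : Term 𝒜} {k : ℕ} {p : Fin k → ℝ} {U : Fin k → Term 𝒜}
    (h : Collective T k p U) (hT : T.IsProc) :
    2 ≤ k ∧ (∀ i, 0 < p i ∧ p i < 1) ∧ ∑ i, p i = 1 := by
  induction h with
  | choice p T => exact ⟨hT.1.1, hT.1.2.1, hT.1.2.2.1⟩
  | fix _ ih => exact ih hT.unfold

/-! ### Finiteness of the state space -/

/-- Simultaneous substitution (not avoiding capture). -/
def msubst : (ℕ → Term 𝒜) → Term 𝒜 → Term 𝒜
  | _, nil => nil
  | σ, var X => σ X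
  | σ, sum n α T => sum n α fun i => msubst σ (T i)
  | σ, choice n p T => choice n p fun i => msubst σ (T i)
  | σ, fix Y T => fix Y (msubst (Function.update σ Y (var Y)) T)

theorem msubst_var (T : Term 𝒜) : msubst var T = T := by
  induction T with
  | nil => rfl
  | var Y => rfl
  | sum n α T ih => simp only [msubst, ih]
  | choice n p T ih => simp only [msubst, ih]
  | fix Y T ih => simp only [msubst, Function.update_eq_self, ih]

theorem exists_free_of_free_msubst {T : Term 𝒜} {Y : ℕ} :
    ∀ {σ : ℕ → Term 𝒜}, (msubst σ T).Free Y → ∃ X, T.Free X ∧ (σ X).Free Y := by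
  induction T with
  | nil => intro σ h; exact h.elim
  | var Z => intro σ h; exact ⟨Z, rfl, h⟩
  | sum n α T ih => rintro σ ⟨i, hi⟩; obtain ⟨X, h1, h2⟩ := ih i hi; exact ⟨X, ⟨i, h1⟩, h2⟩
  | choice n p T ih => rintro σ ⟨i, hi⟩; obtain ⟨X, h1, h2⟩ := ih i hi; exact ⟨X, ⟨i, h1⟩, h2⟩
  | fix Z T ih =>
    rintro σ ⟨hYZ, h⟩
    obtain ⟨X, h1, h2⟩ := ih h
    by_cases hX : X = Z
    · subst hX
      rw [Function.update_self] at h2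
      exact (hYZ h2.symm).elim
    · rw [Function.update_of_ne hX] at h2
      exact ⟨X, ⟨hX, h1⟩, h2⟩

/-- The hypothesis keeps `Y` out of the terms put in for other variables, so the only `Y` left to
replace is the one retained by the update. This identifies the unfolding of an instance of a
fixpoint with an instance of its body. -/
theorem subst_msubst {T S : Term 𝒜} {Y : ℕ} : ∀ {σ : ℕ → Term 𝒜},
    (∀ X, X ≠ Y → T.Free X → ¬ (σ X).Free Y) →
    subst Y S (msubst (Function.update σ Y (var Y)) T) = msubst (Function.update σ Y S) T := by
  have key : ∀ {V : Term 𝒜}, ¬ V.Free Y → subst Y S V = V := by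
    intro V
    induction V with
    | nil => intro _; rfl
    | var Z => intro h; exact if_neg h
    | sum n α T ih =>
      intro h; simp only [subst]; congr; funext i; exact ih i fun hi => h ⟨i, hi⟩
    | choice n p T ih =>
      intro h; simp only [subst]; congr; funext i; exact ih i fun hi => h ⟨i, hi⟩
    | fix Z T ih =>
      intro h
      by_cases hZ : Z = Y
      · simp only [subst, hZ, if_true]
      · simp only [subst, hZ, if_false]
        rw [ih fun hT => h ⟨fun e => hZ e.symm, hT⟩]
  induction T with
  | nil => intro σ _; rfl
  | var Z =>
    intro σ h
    by_cases hZ : Z = Y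
    · subst hZ; simp [msubst, subst]
    · simp only [msubst, Function.update_of_ne hZ]
      exact key (h Z hZ rfl)
  | sum n α T ih =>
    intro σ h
    simp only [msubst, subst]; congr; funext i
    exact ih i fun X hX hf => h X hX ⟨i, hf⟩
  | choice n p T ih =>
    intro σ h
    simp only [msubst, subst]; congr; funext i
    exact ih i fun X hX hf => h X hX ⟨i, hf⟩
  | fix Z T ih =>
    intro σ h
    by_cases hZ : Z = Y
    · subst hZ; simp [msubst, subst]
    · simp only [msubst, subst, hZ, if_false]
      rw [Function.update_comm (Ne.symm hZ), Function.update_comm (Ne.symm hZ), ih]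
      intro X hX hf
      by_cases hXZ : X = Z
      · subst hXZ; rw [Function.update_self]; exact hZ
      · rw [Function.update_of_ne hXZ]; exact h X hX ⟨hXZ, hf⟩

/-- The instances under `σ` of the subterms of `T`, with variables bound by a fixpoint replaced by
this fixpoint. -/
def derivatives : (ℕ → Term 𝒜) → Term 𝒜 → Set (Term 𝒜)
  | _, nil => {nil}
  | σ, var X => {σ X}
  | σ, sum n α T => insert (msubst σ (sum n α T)) (⋃ i, derivatives σ (T i))
  | σ, choice n p T => insert (msubst σ (choice n p T)) (⋃ i, derivatives σ (T i))
  | σ, fix Y T => insert (msubst σ (fix Y T))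
      (derivatives (Function.update σ Y (msubst σ (fix Y T))) T)

theorem finite_derivatives (T : Term 𝒜) : ∀ σ : ℕ → Term 𝒜, (derivatives σ T).Finite := by
  induction T with
  | nil => intro σ; exact Set.finite_singleton _
  | var Z => intro σ; exact Set.finite_singleton _
  | sum n α T ih => intro σ; exact (Set.finite_iUnion fun i => ih i σ).insert _
  | choice n p T ih => intro σ; exact (Set.finite_iUnion fun i => ih i σ).insert _
  | fix Y T ih => intro σ; exact (ih _).insert _

theorem msubst_mem_derivatives (σ : ℕ → Term 𝒜) (T : Term 𝒜) :
    msubst σ T ∈ derivatives σ T := by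
  cases T with
  | nil => rfl
  | var Z => rfl
  | sum n α T => exact .inl rfl
  | choice n p T => exact .inl rfl
  | fix Y T => exact .inl rfl

theorem closed_update {σ : ℕ → Term 𝒜} {Y : ℕ} {T : Term 𝒜}
    (h : ∀ X, (fix Y T).Free X → (σ X).Closed) (X : ℕ) (hX : T.Free X) :
    (Function.update σ Y (msubst σ (fix Y T)) X).Closed := by
  by_cases hXY : X = Y
  · subst hXY
    rw [Function.update_self]
    intro Z hZ
    obtain ⟨W, h1, h2⟩ := exists_free_of_free_msubst hZ
    exact h W h1 Z h2
  · rw [Function.update_of_ne hXY]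
    exact h X ⟨hXY, hX⟩

/-- A transition of an instance of `T` is a transition of `T`, or one of the terms substituted for
an unguarded variable. -/
theorem Step.of_msubst {Z U : Term 𝒜} {l : Label 𝒜} (h : Step Z l U) :
    ∀ {σ : ℕ → Term 𝒜} {T : Term 𝒜}, Z = msubst σ T → T.WellFormed →
      (∀ X, T.Free X → (σ X).Closed) →
      U ∈ derivatives σ T ∨ ∃ X, T.Free X ∧ ¬ T.Guarded X ∧ Step (σ X) l U := by
  induction h with
  | sum α V i =>
    intro σ T hZ hT hσ
    cases T with
    | nil => cases hZ
    | var X =>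
      simp only [msubst] at hZ
      exact .inr ⟨X, rfl, fun h => h rfl, hZ ▸ .sum α V i⟩
    | sum n α' T =>
      simp only [msubst] at hZ; cases hZ
      exact .inl (.inr (Set.mem_iUnion.2 ⟨i, msubst_mem_derivatives σ (T i)⟩))
    | choice n p T => cases hZ
    | fix Y T => cases hZ
  | choice p V i =>
    intro σ T hZ hT hσ
    cases T with
    | nil => cases hZ
    | var X =>
      simp only [msubst] at hZ
      exact .inr ⟨X, rfl, fun h => h rfl, hZ ▸ .choice p V i⟩
    | sum n α' T => cases hZ
    | choice n p T =>
      simp only [msubst] at hZ; cases hZ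
      exact .inl (.inr (Set.mem_iUnion.2 ⟨i, msubst_mem_derivatives σ (T i)⟩))
    | fix Y T => cases hZ
  | @fix X V V' l hs ih =>
    intro σ T hZ hT hσ
    cases T with
    | nil => cases hZ
    | var X =>
      simp only [msubst] at hZ
      exact .inr ⟨X, rfl, fun h => h rfl, hZ ▸ .fix hs⟩
    | sum n α' T => cases hZ
    | choice n p T => cases hZ
    | fix Y T =>
      have hZ' := hZ
      simp only [msubst] at hZ'
      injection hZ' with h1 h2
      subst h1
      have key : subst X (.fix X V) V
          = msubst (Function.update σ X (msubst σ (.fix X T))) T := by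
        rw [hZ, h2]
        exact subst_msubst fun W hW hf => hσ W ⟨hW, hf⟩ X
      rcases ih key hT.2 (closed_update hσ) with h | ⟨W, h1, h2, h3⟩
      · exact .inl (.inr h)
      -- Here guardedness of the fixpoint enters: its own variable is guarded in the body, so the
      -- unguarded `W` is another one, where the update has no effect.
      · have hWX : W ≠ X := fun e => h2 (e ▸ hT.1)
        rw [Function.update_of_ne hWX] at h3
        exact .inr ⟨W, ⟨hWX, h1⟩, fun h => h.elim (fun e => hWX e.symm) h2, h3⟩

/-- Transitions can leave the finite set of derivatives only through the terms substituted for free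
variables. A process has none, so its derivatives contain everything reachable. -/
theorem Step.mem_derivatives {T : Term 𝒜} {U U' : Term 𝒜} {l : Label 𝒜} (h : Step U l U') :
    ∀ {σ : ℕ → Term 𝒜}, T.WellFormed → (∀ X, T.Free X → (σ X).Closed) →
      U ∈ derivatives σ T → U' ∈ derivatives σ T ∨ ∃ X, T.Free X ∧ Step (σ X) l U' := by
  have weaken : ∀ {σ : ℕ → Term 𝒜} {T : Term 𝒜}, U = msubst σ T → T.WellFormed →
      (∀ X, T.Free X → (σ X).Closed) →
      U' ∈ derivatives σ T ∨ ∃ X, T.Free X ∧ Step (σ X) l U' := fun h1 h2 h3 =>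
    (h.of_msubst h1 h2 h3).imp id fun ⟨X, h, _, h'⟩ => ⟨X, h, h'⟩
  induction T with
  | nil => intro σ hT hσ hU; exact weaken hU hT hσ
  | var Z => intro σ hT hσ hU; exact weaken hU hT hσ
  | sum n α T ih =>
    rintro σ hT hσ (hU | hU)
    · exact weaken hU hT hσ
    · obtain ⟨i, hi⟩ := Set.mem_iUnion.1 hU
      rcases ih i (hT.2 i) (fun X hX => hσ X ⟨i, hX⟩) hi with h | ⟨X, h1, h2⟩
      · exact .inl (.inr (Set.mem_iUnion.2 ⟨i, h⟩))
      · exact .inr ⟨X, ⟨i, h1⟩, h2⟩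
  | choice n p T ih =>
    rintro σ hT hσ (hU | hU)
    · exact weaken hU hT hσ
    · obtain ⟨i, hi⟩ := Set.mem_iUnion.1 hU
      rcases ih i (hT.2.2.2 i) (fun X hX => hσ X ⟨i, hX⟩) hi with h | ⟨X, h1, h2⟩
      · exact .inl (.inr (Set.mem_iUnion.2 ⟨i, h⟩))
      · exact .inr ⟨X, ⟨i, h1⟩, h2⟩
  | fix Y T ih =>
    rintro σ hT hσ (hU | hU)
    · exact weaken hU hT hσ
    · rcases ih hT.2 (closed_update hσ) hU with h | ⟨X, h1, h2⟩
      · exact .inl (.inr h)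
      · by_cases hXY : X = Y
        -- The term substituted for the bound variable is the instance of the fixpoint itself, so
        -- its transitions are already covered.
        · subst hXY
          rw [Function.update_self] at h2
          exact (h2.of_msubst rfl hT hσ).imp id fun ⟨X, h, _, h'⟩ => ⟨X, h, h'⟩
        · rw [Function.update_of_ne hXY] at h2
          exact .inr ⟨X, ⟨hXY, h1⟩, h2⟩

end Term

variable {𝒜 : Type*}

theorem finite_reachable (A : Proc 𝒜) : {B | Reachable A B}.Finite := by
  have key : ∀ B, Reachable A B → B.1 ∈ Term.derivatives Term.var A.1 := by
    intro B h
    induction h with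
    | refl =>
      have := Term.msubst_mem_derivatives Term.var A.1
      rwa [Term.msubst_var] at this
    | tail _ hs ih =>
      obtain ⟨l, hl⟩ := hs
      rcases Term.Step.mem_derivatives hl A.2.1 (fun X hX => (A.2.2 X hX).elim) ih with h | ⟨X, h, _⟩
      · exact h
      · exact (A.2.2 X h).elim
  exact ((Term.finite_derivatives A.1 Term.var).preimage Subtype.val_injective.injOn).subset key

/-! ### Collective transitions of processes -/

theorem Collective.unique {A : Proc 𝒜} {k : ℕ} {p : Fin k → ℝ} {B : Fin k → Proc 𝒜}
    (h : Collective A k p B) {k' : ℕ} {p' : Fin k' → ℝ} {B' : Fin k' → Proc 𝒜}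
    (h' : Collective A k' p' B') :
    (⟨k, p, B⟩ : Σ k, (Fin k → ℝ) × (Fin k → Proc 𝒜)) = ⟨k', p', B'⟩ := by
  have := Term.Collective.unique h h'
  rw [Sigma.mk.injEq] at this
  obtain ⟨rfl, h2⟩ := this
  have h2 := eq_of_heq h2
  rw [Prod.mk.injEq] at h2
  obtain ⟨rfl, h3⟩ := h2
  have : B = B' := funext fun i => Subtype.ext (congrFun h3 i)
  rw [this]

theorem Collective.two_le {A : Proc 𝒜} {k : ℕ} {p : Fin k → ℝ} {B : Fin k → Proc 𝒜}
    (h : Collective A k p B) : 2 ≤ k := (Term.Collective.probs h A.2).1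

theorem Collective.pos {A : Proc 𝒜} {k : ℕ} {p : Fin k → ℝ} {B : Fin k → Proc 𝒜}
    (h : Collective A k p B) (i : Fin k) : 0 < p i := ((Term.Collective.probs h A.2).2.1 i).1

theorem Collective.lt_one {A : Proc 𝒜} {k : ℕ} {p : Fin k → ℝ} {B : Fin k → Proc 𝒜}
    (h : Collective A k p B) (i : Fin k) : p i < 1 := ((Term.Collective.probs h A.2).2.1 i).2

theorem Collective.sum_eq {A : Proc 𝒜} {k : ℕ} {p : Fin k → ℝ} {B : Fin k → Proc 𝒜}
    (h : Collective A k p B) : ∑ i, p i = 1 := (Term.Collective.probs h A.2).2.2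

theorem Step.exists_collective {A D : Proc 𝒜} {r : ℝ} (h : Step A (.prob r) D) :
    ∃ (k : ℕ) (p : Fin k → ℝ) (B : Fin k → Proc 𝒜) (i : Fin k),
      Collective A k p B ∧ p i = r ∧ B i = D := by
  obtain ⟨k, p, U, i, hc, h1, h2⟩ := Term.Step.exists_collective h rfl
  exact ⟨k, p, fun i => ⟨U i, (hc.step i).isProc A.2⟩, i, hc, h1, Subtype.ext h2⟩

/-! ### Leaf probabilities of trees -/

namespace LTree

variable {S : Type*} (t : LTree S)

/-- The probability of reaching a leaf from `v` within `k` steps. -/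
def leafProb : ℕ → List ℕ → ℝ
  | 0, v => if t.arity v = 0 then 1 else 0
  | k + 1, v => if t.arity v = 0 then 1 else
      ∑ i ∈ Finset.range (t.arity v), t.weight (i :: v) * leafProb k (i :: v)

/-- The leaves that can be reached from `v` within `k` steps. -/
def leavesBelow : ℕ → List ℕ → Finset (List ℕ)
  | 0, v => if t.arity v = 0 then {v} else ∅
  | k + 1, v => if t.arity v = 0 then {v} else
      (Finset.range (t.arity v)).biUnion fun i => leavesBelow k (i :: v)

variable {t}

theorem IsNode.of_suffix {u v : List ℕ} (hu : t.IsNode u) (h : v <:+ u) : t.IsNode v := by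
  induction hu with
  | root => rw [List.suffix_nil.1 h]; exact .root
  | child hw hi ih =>
    rcases List.suffix_cons_iff.1 h with rfl | h
    · exact .child hw hi
    · exact ih h

theorem IsNode.lt_arity {v : List ℕ} {i : ℕ} (h : t.IsNode (i :: v)) : i < t.arity v := by
  cases h with | child _ hi => exact hi

theorem exists_child_suffix {u v : List ℕ} (h : v <:+ u) (hne : u ≠ v) : ∃ i, i :: v <:+ u := by
  induction u with
  | nil => exact (hne (List.suffix_nil.1 h).symm).elim
  | cons a w ih =>
    rcases List.suffix_cons_iff.1 h with rfl | h
    · exact (hne rfl).elim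
    · by_cases hw : w = v
      · subst hw; exact ⟨a, List.suffix_refl _⟩
      · obtain ⟨i, hi⟩ := ih h hw
        exact ⟨i, hi.trans (List.suffix_cons a w)⟩

theorem mem_leavesBelow {k : ℕ} : ∀ {v : List ℕ}, t.IsNode v → ∀ {u : List ℕ},
    u ∈ t.leavesBelow k v ↔ t.IsLeaf u ∧ v <:+ u ∧ u.length ≤ v.length + k := by
  have leaf : ∀ {v : List ℕ}, t.IsNode v → t.arity v = 0 → ∀ {u : List ℕ} (k : ℕ),
      u ∈ ({v} : Finset (List ℕ)) ↔ t.IsLeaf u ∧ v <:+ u ∧ u.length ≤ v.length + k := by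
    intro v hv h0 u k
    rw [Finset.mem_singleton]
    constructor
    · rintro rfl; exact ⟨⟨hv, h0⟩, List.suffix_refl _, Nat.le_add_right _ _⟩
    · rintro ⟨hu, hs, -⟩
      by_contra hne
      obtain ⟨i, hi⟩ := exists_child_suffix hs hne
      have := (hu.1.of_suffix hi).lt_arity
      omega
  induction k with
  | zero =>
    intro v hv u
    by_cases h0 : t.arity v = 0
    · simp only [leavesBelow, h0, if_true]; exact leaf hv h0 0
    · simp only [leavesBelow, h0, if_false, Finset.notMem_empty, false_iff]
      rintro ⟨hu, hs, hl⟩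
      have : v = u := hs.eq_of_length_le (by omega)
      exact h0 (this ▸ hu.2)
  | succ k ih =>
    intro v hv u
    by_cases h0 : t.arity v = 0
    · simp only [leavesBelow, h0, if_true]; exact leaf hv h0 _
    · simp only [leavesBelow, h0, if_false, Finset.mem_biUnion, Finset.mem_range]
      constructor
      · rintro ⟨i, hi, hu⟩
        obtain ⟨h1, h2, h3⟩ := (ih (hv.child hi)).1 hu
        refine ⟨h1, (List.suffix_cons i v).trans h2, ?_⟩
        simp only [List.length_cons] at h3
        omega
      · rintro ⟨hu, hs, hl⟩
        have hne : u ≠ v := by rintro rfl; exact h0 hu.2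
        obtain ⟨i, hi⟩ := exists_child_suffix hs hne
        have hlt := (hu.1.of_suffix hi).lt_arity
        refine ⟨i, hlt, (ih (hv.child hlt)).2 ⟨hu, hi, ?_⟩⟩
        simp only [List.length_cons]
        omega

theorem sum_leavesBelow (k : ℕ) : ∀ {v : List ℕ}, t.IsNode v →
    ∑ u ∈ t.leavesBelow k v, t.pathProb u = t.pathProb v * t.leafProb k v := by
  induction k with
  | zero =>
    intro v hv
    by_cases h0 : t.arity v = 0 <;> simp [leavesBelow, leafProb, h0]
  | succ k ih =>
    intro v hv
    by_cases h0 : t.arity v = 0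
    · simp [leavesBelow, leafProb, h0]
    · simp only [leavesBelow, leafProb, h0, if_false]
      rw [Finset.sum_biUnion, Finset.mul_sum]
      · refine Finset.sum_congr rfl fun i hi => ?_
        rw [ih (hv.child (Finset.mem_range.1 hi)), pathProb, mul_assoc]
      -- Two suffixes `i :: v` and `j :: v` of the same address have equal length and hence
      -- coincide.
      · intro i hi j hj hij
        rw [Function.onFun, Finset.disjoint_left]
        intro u hu hu'
        have h1 := ((mem_leavesBelow (hv.child (Finset.mem_range.1 hi))).1 hu).2.1
        have h2 := ((mem_leavesBelow (hv.child (Finset.mem_range.1 hj))).1 hu').2.1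
        have := (List.suffix_of_suffix_length_le h1 h2 (by simp)).eq_of_length (by simp)
        exact hij (List.cons.inj this).1

/-- Replaces the sum over leaves by a recursion over children, on which the limit arguments below
run. -/
theorem probUpTo_eq_leafProb (k : ℕ) : t.probUpTo k = t.leafProb k [] := by
  have h := sum_leavesBelow (t := t) k .root
  rw [pathProb, one_mul] at h
  rw [← h, probUpTo]
  refine Finset.sum_congr ?_ fun _ _ => rfl
  ext u
  rw [mem_leavesBelow .root]
  simp [List.nil_suffix]

end LTree

/-! ### Moves -/

/-- `M` has a `τ`-transition to `B 0`, or a collective silent transition to the `B i`; these are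
the possible branchings of an `ε`-tree. -/
structure EpsMove (M : Proc 𝒜) (k : ℕ) (p : ℕ → ℝ) (B : ℕ → Proc 𝒜) : Prop where
  pos : 0 < k
  tau : k = 1 → Step M (.act .tau) (B 0) ∧ p 0 = 1
  collective : 2 ≤ k → Collective M k (fun i => p i) (fun i => B i)

theorem EpsMove.of_tau {M N : Proc 𝒜} (h : Step M (.act .tau) N) :
    EpsMove M 1 (fun _ => 1) (fun _ => N) :=
  ⟨one_pos, fun _ => ⟨h, rfl⟩, fun h => by omega⟩

theorem Collective.exists_epsMove {M : Proc 𝒜} {k : ℕ} {p : Fin k → ℝ} {B : Fin k → Proc 𝒜}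
    (h : Collective M k p B) : ∃ (p' : ℕ → ℝ) (B' : ℕ → Proc 𝒜), EpsMove M k p' B' ∧
      (∀ i : Fin k, p' i = p i) ∧ ∀ i : Fin k, B' i = B i := by
  have hk := h.two_le
  -- The values from `k` on are irrelevant; `B 0` exists as a default because a collective
  -- transition has at least two branches.
  refine ⟨fun i => if hi : i < k then p ⟨i, hi⟩ else 0,
    fun i => if hi : i < k then B ⟨i, hi⟩ else B ⟨0, by omega⟩, ⟨by omega, fun h => by omega, ?_⟩,
    ?_, ?_⟩
  · intro _; simpa using h
  · intro i; simp
  · intro i; simp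

theorem EpsMove.weight_pos {M : Proc 𝒜} {k : ℕ} {p : ℕ → ℝ} {B : ℕ → Proc 𝒜}
    (h : EpsMove M k p B) {i : ℕ} (hi : i < k) : 0 < p i := by
  by_cases h1 : k = 1
  · obtain rfl : i = 0 := by omega
    rw [(h.tau h1).2]; exact one_pos
  · have := h.pos
    exact (h.collective (by omega)).pos ⟨i, hi⟩

theorem EpsMove.weight_le {M : Proc 𝒜} {k : ℕ} {p : ℕ → ℝ} {B : ℕ → Proc 𝒜}
    (h : EpsMove M k p B) {i : ℕ} (hi : i < k) : p i ≤ 1 := by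
  by_cases h1 : k = 1
  · obtain rfl : i = 0 := by omega
    rw [(h.tau h1).2]
  · have := h.pos
    exact ((h.collective (by omega)).lt_one ⟨i, hi⟩).le

theorem EpsMove.sum_eq {M : Proc 𝒜} {k : ℕ} {p : ℕ → ℝ} {B : ℕ → Proc 𝒜}
    (h : EpsMove M k p B) : ∑ i ∈ Finset.range k, p i = 1 := by
  by_cases h1 : k = 1
  · subst h1; simpa using (h.tau rfl).2
  · have := h.pos
    have := (h.collective (by omega)).sum_eq
    rwa [Finset.sum_range]

theorem EpsMove.exists_silent {M : Proc 𝒜} {k : ℕ} {p : ℕ → ℝ} {B : ℕ → Proc 𝒜}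
    (h : EpsMove M k p B) {i : ℕ} (hi : i < k) : ∃ l, IsSilent l ∧ Step M l (B i) := by
  by_cases h1 : k = 1
  · obtain rfl : i = 0 := by omega
    exact ⟨_, .inl rfl, (h.tau h1).1⟩
  · have := h.pos
    have hc := h.collective (by omega)
    exact ⟨_, .inr ⟨_, hc.pos ⟨i, hi⟩, hc.lt_one ⟨i, hi⟩, rfl⟩, Term.Collective.step hc ⟨i, hi⟩⟩

theorem exists_epsMove_of_silent {M N : Proc 𝒜} {l : Label 𝒜} (hl : IsSilent l)
    (h : Step M l N) : ∃ k p B, EpsMove M k p B ∧ ∃ j < k, B j = N := by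
  rcases hl with rfl | ⟨r, -, -, rfl⟩
  · exact ⟨1, _, _, .of_tau h, 0, one_pos, rfl⟩
  · obtain ⟨k, p, B, i, hc, -, rfl⟩ := h.exists_collective
    obtain ⟨p', B', hm, -, hB⟩ := hc.exists_epsMove
    exact ⟨k, p', B', hm, i, i.2, hB i⟩

/-- The branches of a move are those of the collective silent transition, if there is one. -/
theorem EpsMove.of_collective {M : Proc 𝒜} {k : ℕ} {p : ℕ → ℝ} {B : ℕ → Proc 𝒜}
    (h : EpsMove M k p B) {k' : ℕ} {p' : Fin k' → ℝ} {B' : Fin k' → Proc 𝒜}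
    (hc : Collective M k' p' B') (i : Fin k') : ∃ j < k, B j = B' i := by
  by_cases h1 : k = 1
  · exact (Term.Collective.not_step_act hc (h.tau h1).1).elim
  · have := h.pos
    have := (h.collective (by omega)).unique hc
    rw [Sigma.mk.injEq] at this
    obtain ⟨rfl, h2⟩ := this
    have h2 := eq_of_heq h2
    rw [Prod.mk.injEq] at h2
    exact ⟨i, i.2, congrFun h2.2 i⟩

/-- `M` has a move into `W`. -/
def CanStay (W : Set (Proc 𝒜)) (M : Proc 𝒜) : Prop :=
  ∃ k p B, EpsMove M k p B ∧ ∀ i < k, B i ∈ W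

theorem CanStay.mono {W W' : Set (Proc 𝒜)} {M : Proc 𝒜} (h : CanStay W M) (hW : W ⊆ W') :
    CanStay W' M := by
  obtain ⟨k, p, B, hm, hB⟩ := h
  exact ⟨k, p, B, hm, fun i hi => hW (hB i hi)⟩

/-- By moves into `W`, one can reach `P` with positive probability from `M`. -/
inductive CanReach (W : Set (Proc 𝒜)) (P : Proc 𝒜 → Prop) : Proc 𝒜 → Prop
  | leaf {M : Proc 𝒜} : P M → CanReach W P M
  | move {M : Proc 𝒜} {k : ℕ} {p : ℕ → ℝ} {B : ℕ → Proc 𝒜} {j : ℕ} :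
      EpsMove M k p B → (∀ i < k, B i ∈ W) → j < k → CanReach W P (B j) → CanReach W P M

theorem CanReach.mono {W W' : Set (Proc 𝒜)} {P P' : Proc 𝒜 → Prop} {M : Proc 𝒜}
    (h : CanReach W P M) (hM : M ∈ W) (hW : W ⊆ W') (hP : ∀ M ∈ W, P M → P' M) :
    CanReach W' P' M := by
  induction h with
  | leaf h => exact .leaf (hP _ hM h)
  | move hm hB hj _ ih => exact .move hm (fun i hi => hW (hB i hi)) hj (ih (hB _ hj))

theorem CanReach.bind {W : Set (Proc 𝒜)} {P P' : Proc 𝒜 → Prop} {M : Proc 𝒜}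
    (h : CanReach W P M) (hP : ∀ M, P M → CanReach W P' M) : CanReach W P' M := by
  induction h with
  | leaf h => exact hP _ h
  | move hm hB hj _ ih => exact .move hm hB hj ih

theorem CanReach.exists_silentReach {W : Set (Proc 𝒜)} {P : Proc 𝒜 → Prop} {M : Proc 𝒜}
    (h : CanReach W P M) : ∃ N, SilentReach M N ∧ P N := by
  induction h with
  | leaf h => exact ⟨_, .refl, h⟩
  | move hm hB hj _ ih =>
    obtain ⟨N, h1, h2⟩ := ih
    exact ⟨N, .head (hm.exists_silent hj) h1, h2⟩

/-- `P` or a move into `W`. -/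
theorem CanReach.or_canStay {W : Set (Proc 𝒜)} {P : Proc 𝒜 → Prop} {M : Proc 𝒜}
    (h : CanReach W P M) : P M ∨ CanStay W M := by
  cases h with
  | leaf h => exact .inl h
  | move hm hB hj _ => exact .inr ⟨_, _, _, hm, hB⟩

/-- From `A`, one can reach `P` almost surely inside `[A]_E`. -/
def AlmostSure (E : Proc 𝒜 → Proc 𝒜 → Prop) (P : Proc 𝒜 → Prop) (A : Proc 𝒜) : Prop :=
  ∃ W ⊆ cls E A, A ∈ W ∧ ∀ M ∈ W, CanReach W P M

/-! ### From trees to sets of processes -/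

section Tree

variable {E : Proc 𝒜 → Proc 𝒜 → Prop} {A : Proc 𝒜} {t : LTree (Proc 𝒜)}

theorem IsEpsTree.epsMove (ht : IsEpsTree E A t) {v : List ℕ} (hv : t.IsNode v)
    (h0 : t.arity v ≠ 0) : EpsMove (t.label v) (t.arity v) (fun i => t.weight (i :: v))
      (fun i => t.label (i :: v)) :=
  ⟨Nat.pos_of_ne_zero h0, ht.one_child v hv, ht.children v hv⟩

theorem IsEpsTree.leafProb_mem_Icc (ht : IsEpsTree E A t) (k : ℕ) : ∀ {v : List ℕ},
    t.IsNode v → t.leafProb k v ∈ Set.Icc (0 : ℝ) 1 := by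
  induction k with
  | zero => intro v hv; by_cases h0 : t.arity v = 0 <;> simp [LTree.leafProb, h0]
  | succ k ih =>
    intro v hv
    by_cases h0 : t.arity v = 0
    · simp [LTree.leafProb, h0]
    · simp only [LTree.leafProb, h0, if_false]
      have hm := ht.epsMove hv h0
      constructor
      · refine Finset.sum_nonneg fun i hi => ?_
        have hi := Finset.mem_range.1 hi
        exact mul_nonneg (hm.weight_pos hi).le (ih (hv.child hi)).1
      · refine le_trans (Finset.sum_le_sum fun i hi => ?_) hm.sum_eq.le
        have hi := Finset.mem_range.1 hi
        exact mul_le_of_le_one_right (hm.weight_pos hi).le (ih (hv.child hi)).2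

/-- A node with no leaf below it carries positive probability that is never absorbed, which keeps
the leaf probability at the root away from `1`. -/
theorem IsEpsTree.exists_leaf (ht : IsEpsTree E A t) (hr : t.Regular) {v : List ℕ}
    (hv : t.IsNode v) : ∃ u, t.IsLeaf u ∧ v <:+ u := by
  by_contra! hno
  have bound : ∃ c < (1 : ℝ), ∀ k, t.leafProb k v ≤ c := by
    have h0 : ∀ k {u : List ℕ}, t.IsNode u → v <:+ u → t.leafProb k u = 0 := by
      intro k
      induction k with
      | zero =>
        intro u hu hs
        simp only [LTree.leafProb]
        rw [if_neg fun h0 => hno u ⟨hu, h0⟩ hs]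
      | succ k ih =>
        intro u hu hs
        simp only [LTree.leafProb]
        rw [if_neg fun h0 => hno u ⟨hu, h0⟩ hs]
        refine Finset.sum_eq_zero fun i hi => ?_
        rw [ih (hu.child (Finset.mem_range.1 hi)) (hs.trans (List.suffix_cons i u)), mul_zero]
    exact ⟨0, one_pos, fun k => (h0 k hv (List.suffix_refl v)).le⟩
  have climb : ∀ w : List ℕ, t.IsNode w → (∃ c < (1 : ℝ), ∀ k, t.leafProb k w ≤ c) →
      ∃ c < (1 : ℝ), ∀ k, t.leafProb k [] ≤ c := by
    intro w
    induction w with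
    | nil => exact fun _ h => h
    | cons i u ih =>
      rintro hw ⟨c, hc, hb⟩
      have hu : t.IsNode u := hw.of_suffix (List.suffix_cons i u)
      have hi := hw.lt_arity
      have h0 : t.arity u ≠ 0 := by omega
      have hm := ht.epsMove hu h0
      have hpos := hm.weight_pos hi
      have hc0 : 0 ≤ c := ((ht.leafProb_mem_Icc 0 hw).1).trans (hb 0)
      have hle := hm.weight_le hi
      -- The child `i` loses at least `1 - c`, weighted by its edge; the other children contribute
      -- at most their weights.
      refine ih hu ⟨1 - t.weight (i :: u) * (1 - c), by nlinarith, fun k => ?_⟩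
      cases k with
      | zero => simp only [LTree.leafProb, h0, if_false]; nlinarith
      | succ k =>
        simp only [LTree.leafProb, h0, if_false]
        have hsum := hm.sum_eq
        rw [← Finset.add_sum_erase _ _ (Finset.mem_range.2 hi)] at hsum ⊢
        have h1 : ∑ j ∈ (Finset.range (t.arity u)).erase i,
            t.weight (j :: u) * t.leafProb k (j :: u)
            ≤ ∑ j ∈ (Finset.range (t.arity u)).erase i, t.weight (j :: u) := by
          refine Finset.sum_le_sum fun j hj => ?_
          have hj := Finset.mem_range.1 (Finset.mem_of_mem_erase hj)
          exact mul_le_of_le_one_right (hm.weight_pos hj).le (ht.leafProb_mem_Icc k (hu.child hj)).2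
        have h2 := mul_le_mul_of_nonneg_left (hb k) hpos.le
        linarith
  obtain ⟨c, hc, hb⟩ := climb v hv bound
  have : (1 : ℝ) ≤ c := le_of_tendsto hr (Eventually.of_forall fun k => by
    rw [LTree.probUpTo_eq_leafProb]; exact hb k)
  linarith

/-- The set `W` consists of the labels of all nodes; the path from a node to a leaf below it gives
the moves. -/
theorem IsEpsTree.almostSure {P : Proc 𝒜 → Prop} (ht : IsEpsTree E A t) (hr : t.Regular)
    (hP : ∀ v, t.IsLeaf v → P (t.label v)) : AlmostSure E P A := by
  refine ⟨{M | ∃ v, t.IsNode v ∧ t.label v = M}, ?_, ⟨[], .root, ht.root⟩, ?_⟩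
  · rintro _ ⟨v, hv, rfl⟩; exact ht.mem_class v hv
  · rintro _ ⟨v, hv, rfl⟩
    obtain ⟨u, hu, w, rfl⟩ := ht.exists_leaf hr hv
    have climb : ∀ w : List ℕ, t.IsNode (w ++ v) →
        CanReach {M | ∃ v, t.IsNode v ∧ t.label v = M} P (t.label (w ++ v)) →
        CanReach {M | ∃ v, t.IsNode v ∧ t.label v = M} P (t.label v) := by
      intro w
      induction w with
      | nil => exact fun _ h => h
      | cons i w ih =>
        intro hw h
        have hu : t.IsNode (w ++ v) := hw.of_suffix (List.suffix_cons i _)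
        have hi := hw.lt_arity
        exact ih hu (.move (ht.epsMove hu (Nat.ne_zero_of_lt hi))
          (fun j hj => ⟨j :: (w ++ v), hu.child hj, rfl⟩) hi h)
    exact climb w hu.1 (.leaf (hP _ hu))

theorem IsEpsTree.pathProb_pos (ht : IsEpsTree E A t) {v : List ℕ} (hv : t.IsNode v) :
    0 < t.pathProb v := by
  induction hv with
  | root => exact one_pos
  | child hv hi ih => exact mul_pos ih (ht.weight_mem _ hv _ hi).1

/-- A leaf contributes its positive path probability to every later partial sum, so the limit cannot
be `0`. -/
theorem IsEpsTree.not_isLeaf (ht : IsEpsTree E A t) (hd : t.Divergent) (v : List ℕ) :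
    ¬ t.IsLeaf v := by
  intro hv
  have : t.pathProb v ≤ 0 := by
    refine ge_of_tendsto hd (eventually_atTop.2 ⟨v.length, fun k hk => ?_⟩)
    refine Finset.single_le_sum (f := t.pathProb) (fun u hu => ?_) ?_
    · rw [Set.Finite.mem_toFinset] at hu
      exact (ht.pathProb_pos hu.1.1).le
    · rw [Set.Finite.mem_toFinset]; exact ⟨hv, hk⟩
  exact (ht.pathProb_pos hv.1).not_ge this

end Tree

theorem Diverges.exists_set {E : Proc 𝒜 → Proc 𝒜 → Prop} {A : Proc 𝒜} (h : Diverges E A) :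
    ∃ W ⊆ cls E A, A ∈ W ∧ ∀ M ∈ W, CanStay W M := by
  obtain ⟨t, ht, hd⟩ := h
  refine ⟨{M | ∃ v, t.IsNode v ∧ t.label v = M}, ?_, ⟨[], .root, ht.root⟩, ?_⟩
  · rintro _ ⟨v, hv, rfl⟩; exact ht.mem_class v hv
  · rintro _ ⟨v, hv, rfl⟩
    exact ⟨_, _, _, ht.epsMove hv fun h0 => ht.not_isLeaf hd v ⟨hv, h0⟩,
      fun i hi => ⟨i :: v, hv.child hi, rfl⟩⟩

/-! ### From sets of processes to trees -/

/-- A scheduler on `W`: a choice of a move into `W`, or of stopping (arity `0`), at each process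
of `W`. -/
structure Scheduler (W : Set (Proc 𝒜)) where
  arity : Proc 𝒜 → ℕ
  weight : Proc 𝒜 → ℕ → ℝ
  next : Proc 𝒜 → ℕ → Proc 𝒜
  epsMove : ∀ M ∈ W, arity M ≠ 0 → EpsMove M (arity M) (weight M) (next M)
  next_mem : ∀ M ∈ W, ∀ i < arity M, next M i ∈ W

namespace Scheduler

variable {W : Set (Proc 𝒜)} (s : Scheduler W)

/-- The process at an address of the tree of the runs of `s` from `A`. -/
def run (A : Proc 𝒜) : List ℕ → Proc 𝒜
  | [] => A
  | i :: v => s.next (run A v) i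

/-- The tree of the runs of `s` from `A`. -/
def tree (A : Proc 𝒜) : LTree (Proc 𝒜) where
  arity v := s.arity (s.run A v)
  label v := s.run A v
  weight
    | [] => 1
    | i :: v => s.weight (s.run A v) i

variable {s} {A : Proc 𝒜}

theorem run_mem (hA : A ∈ W) {v : List ℕ} (hv : (s.tree A).IsNode v) : s.run A v ∈ W := by
  induction hv with
  | root => exact hA
  | child _ hi ih => exact s.next_mem _ ih _ hi

theorem isEpsTree (hA : A ∈ W) {E : Proc 𝒜 → Proc 𝒜 → Prop} (hW : W ⊆ cls E A) :
    IsEpsTree E A (s.tree A) where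
  root := rfl
  mem_class _ hv := hW (run_mem hA hv)
  weight_mem _ hv _ hi :=
    have hm := s.epsMove _ (run_mem hA hv) (Nat.ne_zero_of_lt hi)
    ⟨hm.weight_pos hi, hm.weight_le hi⟩
  one_child _ hv h :=
    (s.epsMove _ (run_mem hA hv) (h.trans_ne one_ne_zero)).tau h
  children _ hv h :=
    (s.epsMove _ (run_mem hA hv) (show s.arity _ ≠ 0 from
      Nat.ne_zero_of_lt (lt_of_lt_of_le two_pos h))).collective h

variable (s)

/-- The probability of stopping within `k` steps. -/
def stopProb : ℕ → Proc 𝒜 → ℝ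
  | 0, M => if s.arity M = 0 then 1 else 0
  | k + 1, M => if s.arity M = 0 then 1 else
      ∑ i ∈ Finset.range (s.arity M), s.weight M i * stopProb k (s.next M i)

theorem leafProb_tree (k : ℕ) : ∀ v, (s.tree A).leafProb k v = s.stopProb k (s.run A v) := by
  induction k with
  | zero => intro v; rfl
  | succ k ih => intro v; simp only [LTree.leafProb, stopProb, ih]; rfl

theorem stopProb_mem_Icc (k : ℕ) : ∀ M ∈ W, s.stopProb k M ∈ Set.Icc (0 : ℝ) 1 := by
  induction k with
  | zero => intro M _; by_cases h0 : s.arity M = 0 <;> simp [stopProb, h0]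
  | succ k ih =>
    intro M hM
    by_cases h0 : s.arity M = 0
    · simp [stopProb, h0]
    · simp only [stopProb, h0, if_false]
      have hm := s.epsMove M hM h0
      constructor
      · refine Finset.sum_nonneg fun i hi => ?_
        have hi := Finset.mem_range.1 hi
        exact mul_nonneg (hm.weight_pos hi).le (ih _ (s.next_mem M hM i hi)).1
      · refine le_trans (Finset.sum_le_sum fun i hi => ?_) hm.sum_eq.le
        have hi := Finset.mem_range.1 hi
        exact mul_le_of_le_one_right (hm.weight_pos hi).le (ih _ (s.next_mem M hM i hi)).2

theorem stopProb_le_succ (k : ℕ) : ∀ M ∈ W, s.stopProb k M ≤ s.stopProb (k + 1) M := by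
  induction k with
  | zero =>
    intro M hM
    by_cases h0 : s.arity M = 0
    · simp [stopProb, h0]
    · have := (s.stopProb_mem_Icc 1 M hM).1
      simpa only [stopProb, h0, if_false] using this
  | succ k ih =>
    intro M hM
    rw [stopProb, stopProb]
    by_cases h0 : s.arity M = 0
    · simp [h0]
    · simp only [h0, if_false]
      refine Finset.sum_le_sum fun i hi => ?_
      have hi := Finset.mem_range.1 hi
      exact mul_le_mul_of_nonneg_left (ih _ (s.next_mem M hM i hi))
        ((s.epsMove M hM h0).weight_pos hi).le

/-- If `W` is finite and `s` can decrease a rank before it stops, then it stops almost surely. -/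
theorem tendsto_stopProb (hfin : W.Finite) (rank : Proc 𝒜 → ℕ)
    (hrank : ∀ M ∈ W, s.arity M ≠ 0 → ∃ i < s.arity M, rank (s.next M i) < rank M)
    (hA : A ∈ W) : Tendsto (fun k => s.stopProb k A) atTop (𝓝 1) := by
  -- Stopping probabilities increase with `k` and are bounded on `W`; outside `W` the limit gets a
  -- dummy value.
  have hlim : ∀ M : Proc 𝒜, ∃ x, M ∈ W → Tendsto (fun k => s.stopProb k M) atTop (𝓝 x) := by
    intro M
    by_cases hM : M ∈ W
    · exact ⟨_, fun _ => tendsto_atTop_ciSup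
        (monotone_nat_of_le_succ fun k => s.stopProb_le_succ k M hM)
        ⟨1, by rintro _ ⟨k, rfl⟩; exact (s.stopProb_mem_Icc k M hM).2⟩⟩
    · exact ⟨0, fun h => (hM h).elim⟩
  choose f hf using hlim
  have halted : ∀ M ∈ W, s.arity M = 0 → f M = 1 := by
    intro M hM h0
    refine tendsto_nhds_unique (hf M hM) ?_
    have : (fun k => s.stopProb k M) = fun _ => 1 := by
      funext k; cases k <;> simp [stopProb, h0]
    rw [this]; exact tendsto_const_nhds
  have hstep : ∀ M ∈ W, s.arity M ≠ 0 →
      f M = ∑ i ∈ Finset.range (s.arity M), s.weight M i * f (s.next M i) := by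
    intro M hM h0
    refine tendsto_nhds_unique ((tendsto_add_atTop_iff_nat 1).2 (hf M hM)) ?_
    simp only [stopProb, h0, if_false]
    exact tendsto_finsetSum _ fun i hi =>
      (hf _ (s.next_mem M hM i (Finset.mem_range.1 hi))).const_mul _
  obtain ⟨M₀, hM₀, hmin⟩ := hfin.exists_minimalFor f W ⟨A, hA⟩
  have hmin : ∀ M ∈ W, f M₀ ≤ f M := fun M hM => (le_total (f M₀) (f M)).elim id (hmin hM)
  -- Minimum principle: `f` is an average over successors with positive weights, so at a minimum all
  -- successors are minima too. Descending in rank, one arrives at a stopped process, where `f` is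
  -- `1`.
  have hone : ∀ n, ∀ M ∈ W, rank M < n → f M = f M₀ → f M = 1 := by
    intro n
    induction n with
    | zero => intro M _ h; omega
    | succ n ih =>
      intro M hM hn hMin
      by_cases h0 : s.arity M = 0
      · exact halted M hM h0
      · obtain ⟨i, hi, hlt⟩ := hrank M hM h0
        have hm := s.epsMove M hM h0
        have hsum : ∑ j ∈ Finset.range (s.arity M), s.weight M j * (f (s.next M j) - f M) = 0 := by
          simp only [mul_sub, Finset.sum_sub_distrib, ← Finset.sum_mul, hm.sum_eq,
            ← hstep M hM h0]
          ring
        have hzero := (Finset.sum_eq_zero_iff_of_nonneg fun j hj => by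
          have hj := Finset.mem_range.1 hj
          have := hmin _ (s.next_mem M hM j hj)
          exact mul_nonneg (hm.weight_pos hj).le (by linarith)).1 hsum i (Finset.mem_range.2 hi)
        have heq : f (s.next M i) = f M := by
          rcases mul_eq_zero.1 hzero with h | h
          · exact ((hm.weight_pos hi).ne' h).elim
          · linarith
        rw [← heq]
        exact ih _ (s.next_mem M hM i hi) (by omega) (heq.trans hMin)
  have h1 : f M₀ = 1 := hone _ M₀ hM₀ (Nat.lt_succ_self _) rfl
  have h2 : f A ≤ 1 := le_of_tendsto (hf A hA)
    (Eventually.of_forall fun k => (s.stopProb_mem_Icc k A hA).2)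
  have h3 : f A = 1 := le_antisymm h2 (h1 ▸ hmin A hA)
  exact h3 ▸ hf A hA

end Scheduler

/-- Reaching `P` by moves into `W` in at most `n` steps. -/
def ReachWithin (W : Set (Proc 𝒜)) (P : Proc 𝒜 → Prop) : ℕ → Proc 𝒜 → Prop
  | 0, M => P M
  | n + 1, M => ∃ k p B, EpsMove M k p B ∧ (∀ i < k, B i ∈ W) ∧ ∃ j < k, ReachWithin W P n (B j)

theorem CanReach.exists_reachWithin {W : Set (Proc 𝒜)} {P : Proc 𝒜 → Prop} {M : Proc 𝒜}
    (h : CanReach W P M) : ∃ n, ReachWithin W P n M := by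
  induction h with
  | leaf h => exact ⟨0, h⟩
  | move hm hB hj _ ih =>
    obtain ⟨n, hn⟩ := ih
    exact ⟨n + 1, _, _, _, hm, hB, _, hj, hn⟩

/-- A memoryless scheduler suffices: each process of `W` takes the first move of a shortest path to
`P`, and stops when this path is empty. The minimum principle makes its tree regular. -/
theorem AlmostSure.exists_tree {E : Proc 𝒜 → Proc 𝒜 → Prop} {P : Proc 𝒜 → Prop} {A : Proc 𝒜}
    (h : AlmostSure E P A) : ∃ t : LTree (Proc 𝒜), IsEpsTree E A t ∧ t.Regular ∧
      ∀ v, t.IsLeaf v → P (t.label v) := by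
  classical
  obtain ⟨W₀, hW₀, hA₀, hR₀⟩ := h
  obtain ⟨W, hWfin, hW, hA, hR⟩ : ∃ W : Set (Proc 𝒜), W.Finite ∧ W ⊆ cls E A ∧ A ∈ W ∧
      ∀ M ∈ W, CanReach W P M := by
    -- Restricting to reachable processes makes the set finite, and moves into `W₀` from reachable
    -- processes remain in it.
    refine ⟨W₀ ∩ {B | Reachable A B}, (finite_reachable A).subset Set.inter_subset_right,
      Set.inter_subset_left.trans hW₀, ⟨hA₀, .refl⟩, ?_⟩
    rintro M ⟨hM, hAM⟩
    induction hR₀ M hM with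
    | leaf h => exact .leaf h
    | move hm hB hj _ ih =>
      have : ∀ i < _, _ ∈ W₀ ∩ {B | Reachable A B} := fun i hi =>
        ⟨hB i hi, hAM.tail (let ⟨l, _, h⟩ := hm.exists_silent hi; ⟨l, h⟩)⟩
      exact .move hm this hj (ih (this _ hj).1 (this _ hj).2)
  have hex : ∀ M, ∃ n, M ∈ W → ReachWithin W P n M ∧ ∀ m < n, ¬ ReachWithin W P m M := by
    intro M
    by_cases hM : M ∈ W
    · have h := (hR M hM).exists_reachWithin
      exact ⟨Nat.find h, fun _ => ⟨Nat.find_spec h, fun m hm => Nat.find_min h hm⟩⟩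
    · exact ⟨0, fun h => (hM h).elim⟩
  choose rank hrank using hex
  have hmove : ∀ M, ∃ (k : ℕ) (p : ℕ → ℝ) (B : ℕ → Proc 𝒜), M ∈ W →
      (k = 0 → P M) ∧ (k ≠ 0 → EpsMove M k p B) ∧ (∀ i < k, B i ∈ W) ∧
      (k ≠ 0 → ∃ i < k, rank (B i) < rank M) := by
    intro M
    by_cases hM : M ∈ W
    · obtain ⟨h1, -⟩ := hrank M hM
      cases hn : rank M with
      | zero =>
        rw [hn] at h1
        exact ⟨0, fun _ => 1, fun _ => M, fun _ => ⟨fun _ => h1, fun h => (h rfl).elim,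
          fun i hi => by omega, fun h => (h rfl).elim⟩⟩
      | succ n =>
        rw [hn] at h1
        obtain ⟨k, p, B, hm, hB, j, hj, hjn⟩ := h1
        refine ⟨k, p, B, fun _ => ⟨fun h => (hm.pos.ne' h).elim, fun _ => hm, hB, fun _ =>
          ⟨j, hj, ?_⟩⟩⟩
        -- The branch `B j` reaches `P` in `n` steps, so its minimal rank cannot exceed `n`.
        by_contra hge
        exact (hrank (B j) (hB j hj)).2 n (by omega) hjn
    · exact ⟨0, fun _ => 1, fun _ => M, fun h => (hM h).elim⟩
  choose k p B hk using hmove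
  let s : Scheduler W := ⟨k, p, B, fun M hM => (hk M hM).2.1, fun M hM => (hk M hM).2.2.1⟩
  refine ⟨s.tree A, s.isEpsTree hA hW, ?_, ?_⟩
  · rw [LTree.Regular]
    have : (s.tree A).probUpTo = fun k => s.stopProb k A := by
      funext k; rw [LTree.probUpTo_eq_leafProb, s.leafProb_tree]; rfl
    rw [this]
    exact s.tendsto_stopProb hWfin rank (fun M hM => (hk M hM).2.2.2) hA
  · rintro v ⟨hv, h0⟩
    exact (hk _ (s.run_mem hA hv)).1 h0

/-- Always choosing a move into `W` yields a tree without leaves, all of whose partial sums vanish.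
-/
theorem diverges_of_set {E : Proc 𝒜 → Proc 𝒜 → Prop} {A : Proc 𝒜} {W : Set (Proc 𝒜)}
    (hW : W ⊆ cls E A) (hA : A ∈ W) (h : ∀ M ∈ W, CanStay W M) : Diverges E A := by
  have hmove : ∀ M, ∃ (k : ℕ) (p : ℕ → ℝ) (B : ℕ → Proc 𝒜), M ∈ W →
      EpsMove M k p B ∧ ∀ i < k, B i ∈ W := by
    intro M
    by_cases hM : M ∈ W
    · obtain ⟨k, p, B, h⟩ := h M hM
      exact ⟨k, p, B, fun _ => h⟩
    · exact ⟨0, fun _ => 1, fun _ => M, fun h => (hM h).elim⟩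
  choose k p B hk using hmove
  let s : Scheduler W := ⟨k, p, B, fun M hM _ => (hk M hM).1, fun M hM => (hk M hM).2⟩
  refine ⟨s.tree A, s.isEpsTree hA hW, ?_⟩
  have : (s.tree A).probUpTo = fun _ => 0 := by
    funext n
    refine Finset.sum_eq_zero fun v hv => ?_
    rw [Set.Finite.mem_toFinset] at hv
    exact ((hk _ (s.run_mem hA hv.1.1)).1.pos.ne' hv.1.2).elim
  rw [LTree.Divergent, this]
  exact tendsto_const_nhds

/-! ### Probabilities of arrival -/

section Arrive

variable {M : Proc 𝒜} {k : ℕ} {p : Fin k → ℝ} {B : Fin k → Proc 𝒜}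

theorem arrive_compl (h : Collective M k p B) (X : Set (Proc 𝒜)) :
    arrive p B Xᶜ = 1 - arrive p B X := by
  rw [← h.sum_eq, arrive, arrive, ← Finset.sum_sub_distrib]
  refine Finset.sum_congr rfl fun i _ => ?_
  by_cases hi : B i ∈ X <;> simp [hi]

theorem arrive_pos_iff (h : Collective M k p B) {X : Set (Proc 𝒜)} :
    0 < arrive p B X ↔ ∃ i, B i ∈ X := by
  constructor
  · intro h0
    by_contra! hno
    rw [arrive, Finset.sum_eq_zero fun i _ => if_neg (hno i)] at h0
    exact lt_irrefl _ h0
  · rintro ⟨i, hi⟩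
    refine Finset.sum_pos' (fun j _ => ?_) ⟨i, Finset.mem_univ i, ?_⟩
    · split_ifs
      exacts [(h.pos j).le, le_rfl]
    · rw [if_pos hi]; exact h.pos i

theorem arrive_lt_one_iff (h : Collective M k p B) {X : Set (Proc 𝒜)} :
    arrive p B X < 1 ↔ ∃ i, B i ∉ X := by
  have := arrive_pos_iff h (X := Xᶜ)
  rw [arrive_compl h, sub_pos] at this
  exact this

/-- The probability of arriving in a union of classes is the sum over these classes. -/
theorem arrive_eq_sum_classes {F : Proc 𝒜 → Proc 𝒜 → Prop} (hF : Equivalence F)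
    {X : Set (Proc 𝒜)} {T : Finset (Set (Proc 𝒜))} (hT : ∀ C ∈ T, C ∈ classes F ∧ C ⊆ X)
    (hB : ∀ i, B i ∈ X → cls F (B i) ∈ T) : arrive p B X = ∑ C ∈ T, arrive p B C := by
  simp only [arrive]
  rw [Finset.sum_comm]
  refine Finset.sum_congr rfl fun i _ => ?_
  by_cases hi : B i ∈ X
  · rw [if_pos hi, Finset.sum_eq_single (cls F (B i)), if_pos (show B i ∈ cls F (B i) from hF.refl _)]
    · intro C hC hne
      refine if_neg fun hm => hne ?_
      obtain ⟨D, rfl⟩ := (hT C hC).1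
      ext N
      exact ⟨fun h => hF.trans (hF.symm hm) h, fun h => hF.trans hm h⟩
    · exact fun h => (h (hB i hi)).elim
  · rw [if_neg hi]
    exact (Finset.sum_eq_zero fun C hC => if_neg fun hm => hi ((hT C hC).2 hm)).symm

/-- A saturated set avoiding `M` is a union of classes other than that of `M`, so a proportionality
valid class by class adds up. It is cross-multiplied by `c` and `c'` to avoid division. -/
theorem arrive_saturated {F : Proc 𝒜 → Proc 𝒜 → Prop} (hF : Equivalence F) {M : Proc 𝒜}
    {k' : ℕ} {p' : Fin k' → ℝ} {B' : Fin k' → Proc 𝒜} {c c' : ℝ}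
    (h : ∀ C ∈ classes F, C ≠ cls F M → arrive p B C * c' = arrive p' B' C * c)
    {X : Set (Proc 𝒜)} (hX : ∀ N N', F N N' → N ∈ X → N' ∈ X) (hM : M ∉ X) :
    arrive p B X * c' = arrive p' B' X * c := by
  classical
  -- Only classes of targets carry probability; those of both transitions are included so that one
  -- index set serves both sides.
  set T : Finset (Set (Proc 𝒜)) := ((Finset.univ.image fun i => cls F (B i)) ∪
    (Finset.univ.image fun i => cls F (B' i))).filter (· ⊆ X) with hTdef
  have hT : ∀ C ∈ T, C ∈ classes F ∧ C ⊆ X := by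
    intro C hC
    obtain ⟨h1, h2⟩ := Finset.mem_filter.1 hC
    refine ⟨?_, h2⟩
    rcases Finset.mem_union.1 h1 with h1 | h1 <;> obtain ⟨i, -, rfl⟩ := Finset.mem_image.1 h1 <;>
      exact ⟨_, rfl⟩
  have hsub : ∀ N ∈ X, cls F N ⊆ X := fun N hN N' h => hX N N' h hN
  rw [arrive_eq_sum_classes hF hT, arrive_eq_sum_classes hF hT, Finset.sum_mul, Finset.sum_mul]
  · refine Finset.sum_congr rfl fun C hC => h C (hT C hC).1 ?_
    rintro rfl
    exact hM ((hT _ hC).2 (hF.refl M))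
  · exact fun i hi => Finset.mem_filter.2 ⟨Finset.mem_union_right _
      (Finset.mem_image_of_mem _ (Finset.mem_univ i)), hsub _ hi⟩
  · exact fun i hi => Finset.mem_filter.2 ⟨Finset.mem_union_left _
      (Finset.mem_image_of_mem _ (Finset.mem_univ i)), hsub _ hi⟩

end Arrive

theorem cls_eq_iff {E : Proc 𝒜 → Proc 𝒜 → Prop} (hE : Equivalence E) {A B : Proc 𝒜} :
    cls E A = cls E B ↔ E A B := by
  constructor
  · intro h
    have : B ∈ cls E B := hE.refl B
    rwa [← h] at this
  · intro h
    ext N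
    exact ⟨fun h' => hE.trans (hE.symm h) h', fun h' => hE.trans h h'⟩

/-! ### Weak transitions without trees -/

/-- The condition on the leaves for an `ℓ`-transition to `C`. -/
def EllLeaf (l : Act 𝒜) (C : Set (Proc 𝒜)) (L : Proc 𝒜) : Prop :=
  ∃ L' ∈ C, Step L (.act l) L'

/-- The condition on the leaves for a `q`-transition to `C`. -/
def QLeaf (E : Proc 𝒜 → Proc 𝒜 → Prop) (q : ℝ) (C : Set (Proc 𝒜)) (L : Proc 𝒜) : Prop :=
  ∃ (k : ℕ) (p : Fin k → ℝ) (B : Fin k → Proc 𝒜),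
    Collective L k p B ∧ arrive p B (cls E L) < 1 ∧
      arrive p B C / (1 - arrive p B (cls E L)) = q

theorem ellTrans_iff {E : Proc 𝒜 → Proc 𝒜 → Prop} {A : Proc 𝒜} {l : Act 𝒜}
    {C : Set (Proc 𝒜)} : EllTrans E A l C ↔ C ∈ classes E ∧
      ((∃ a, l = .ext a) ∨ (l = .tau ∧ C ≠ cls E A)) ∧ AlmostSure E (EllLeaf l C) A :=
  and_congr_right fun _ => and_congr_right fun _ =>
    ⟨fun ⟨_, h1, h2, h3⟩ => h1.almostSure h2 h3, fun h => h.exists_tree⟩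

theorem qTrans_iff {E : Proc 𝒜 → Proc 𝒜 → Prop} {A : Proc 𝒜} {q : ℝ}
    {C : Set (Proc 𝒜)} : QTrans E A q C ↔ C ∈ classes E ∧ C ≠ cls E A ∧
      AlmostSure E (QLeaf E q C) A :=
  and_congr_right fun _ => and_congr_right fun _ =>
    ⟨fun ⟨_, h1, h2, h3⟩ => h1.almostSure h2 h3, fun h => h.exists_tree⟩

theorem AlmostSure.of_leaf {E : Proc 𝒜 → Proc 𝒜 → Prop} {P : Proc 𝒜 → Prop} {A : Proc 𝒜}
    (hE : Equivalence E) (h : P A) : AlmostSure E P A := by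
  refine ⟨{A}, ?_, rfl, ?_⟩
  · rintro _ rfl; exact hE.refl _
  · rintro _ rfl; exact .leaf h

theorem AlmostSure.canReach {E : Proc 𝒜 → Proc 𝒜 → Prop} {P : Proc 𝒜 → Prop} {A : Proc 𝒜}
    (h : AlmostSure E P A) : CanReach (cls E A) P A := by
  obtain ⟨W, h1, h2, h3⟩ := h
  exact (h3 A h2).mono h2 h1 fun _ _ h => h

/-- A process whose collective silent transition may leave `W` has no other moves. -/
theorem CanReach.of_exit {W : Set (Proc 𝒜)} {P : Proc 𝒜 → Prop} {M : Proc 𝒜}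
    (h : CanReach W P M) {k : ℕ} {p : Fin k → ℝ} {B : Fin k → Proc 𝒜}
    (hc : Collective M k p B) {i : Fin k} (hi : B i ∉ W) : P M := by
  cases h with
  | leaf h => exact h
  | move hm hB _ _ =>
    obtain ⟨j, hj, hji⟩ := hm.of_collective hc i
    exact (hi (hji ▸ hB j hj)).elim

/-! ### Simulation of single moves -/

section Transfer

variable {F : Proc 𝒜 → Proc 𝒜 → Prop}

/-- A single transition is a weak one, by the tree consisting only of its root. -/
theorem IsBranchingBisim.transfer_act (hF : IsBranchingBisim F) {M N M' : Proc 𝒜} {l : Act 𝒜}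
    (hMN : F M N) (hs : Step M (.act l) M') (hl : (∃ a, l = .ext a) ∨ (l = .tau ∧ ¬ F M M')) :
    CanReach (cls F N) (EllLeaf l (cls F M')) N := by
  have h : EllTrans F M l (cls F M') := ellTrans_iff.2 ⟨⟨_, rfl⟩,
    hl.imp id fun h => ⟨h.1, fun e => h.2 (hF.equiv.symm ((cls_eq_iff hF.equiv).1 e))⟩,
    .of_leaf hF.equiv ⟨M', hF.equiv.refl _, hs⟩⟩
  exact (ellTrans_iff.1 (hF.ell M N hMN _ ⟨_, rfl⟩ l h)).2.2.canReach

/-- The collective transitions `(p, B)` and `(p', B')` leave the class of `M`, and, conditional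
on leaving this class, they arrive in the same classes with the same probabilities. -/
structure SameExits (F : Proc 𝒜 → Proc 𝒜 → Prop) (M : Proc 𝒜) {k k' : ℕ} (p : Fin k → ℝ)
    (B : Fin k → Proc 𝒜) (p' : Fin k' → ℝ) (B' : Fin k' → Proc 𝒜) : Prop where
  lt_one : arrive p B (cls F M) < 1
  lt_one' : arrive p' B' (cls F M) < 1
  eq : ∀ C ∈ classes F, C ≠ cls F M →
    arrive p B C * (1 - arrive p' B' (cls F M)) = arrive p' B' C * (1 - arrive p B (cls F M))

/-- The definition compares one class at a time, possibly with different trees. One exit of `M` is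
used to find `L`; then every exit probability of `L` is sent back to `M`, whose only possible answer
is its own collective transition. -/
theorem IsBranchingBisim.transfer_collective (hF : IsBranchingBisim F) {M N : Proc 𝒜}
    (hMN : F M N) {k : ℕ} {p : Fin k → ℝ} {B : Fin k → Proc 𝒜} (hc : Collective M k p B)
    {i : Fin k} (hi : ¬ F M (B i)) :
    CanReach (cls F N) (fun L => F M L ∧ ∃ (k' : ℕ) (p' : Fin k' → ℝ) (B' : Fin k' → Proc 𝒜),
      Collective L k' p' B' ∧ SameExits F M p B p' B') N := by
  have hlt : arrive p B (cls F M) < 1 := (arrive_lt_one_iff hc).2 ⟨i, hi⟩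
  have h : QTrans F M (arrive p B (cls F (B i)) / (1 - arrive p B (cls F M))) (cls F (B i)) :=
    qTrans_iff.2 ⟨⟨_, rfl⟩, fun e => hi (hF.equiv.symm ((cls_eq_iff hF.equiv).1 e)),
      .of_leaf hF.equiv ⟨k, p, B, hc, hlt, rfl⟩⟩
  have hN := (qTrans_iff.1 (hF.q M N hMN _ ⟨_, rfl⟩ _ h)).2.2.canReach
  refine hN.mono (hF.equiv.refl N) subset_rfl ?_
  rintro L hL ⟨k', p', B', hc', hlt', -⟩
  have hML : F M L := hF.equiv.trans hMN hL
  have hcls : cls F L = cls F M := (cls_eq_iff hF.equiv).2 (hF.equiv.symm hML)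
  refine ⟨hML, k', p', B', hc', hlt, hcls ▸ hlt', fun C hC hCM => ?_⟩
  have h' : QTrans F L (arrive p' B' C / (1 - arrive p' B' (cls F L))) C :=
    qTrans_iff.2 ⟨hC, hcls.symm ▸ hCM, .of_leaf hF.equiv ⟨k', p', B', hc', hlt', rfl⟩⟩
  have hM := (qTrans_iff.1 (hF.q L M (hF.equiv.symm hML) _ hC _ h')).2.2.canReach
  -- The only move of `M` leaves its class, so the answering tree cannot branch and `M` itself is
  -- the leaf.
  obtain ⟨k₁, p₁, B₁, hc₁, -, hq⟩ := hM.of_exit hc hi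
  cases hc.unique hc₁
  rw [hcls] at hq hlt'
  rw [div_eq_div_iff (by linarith) (by linarith)] at hq
  exact hq

/-- The processes related to an element of `V`. -/
def saturation (F : Proc 𝒜 → Proc 𝒜 → Prop) (V : Set (Proc 𝒜)) : Set (Proc 𝒜) :=
  {N | ∃ M ∈ V, F M N}

/-- Equal normalized exit probabilities imply that both transitions exit to the same classes.
Branches of the answer that do not exit are related to `M`, which lies in `V` too. -/
theorem IsBranchingBisim.transfer_move (hF : IsBranchingBisim F) {V : Set (Proc 𝒜)}
    {M N : Proc 𝒜} (hM : M ∈ V) (hMN : F M N) {k : ℕ} {p : ℕ → ℝ} {B : ℕ → Proc 𝒜}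
    (hm : EpsMove M k p B) (hB : ∀ i < k, B i ∈ V) {j : ℕ} (hj : j < k) (hMj : ¬ F M (B j)) :
    CanReach (cls F N) (fun L => ∃ k' p' B', EpsMove L k' p' B' ∧
      (∀ i < k', B' i ∈ saturation F V) ∧ ∃ j' < k', F (B j) (B' j')) N := by
  by_cases h1 : k = 1
  · obtain rfl : j = 0 := by omega
    refine (hF.transfer_act hMN (hm.tau h1).1 (.inr ⟨rfl, hMj⟩)).mono (hF.equiv.refl N)
      subset_rfl ?_
    rintro L - ⟨L', hL', hs⟩
    exact ⟨1, _, _, .of_tau hs, fun _ _ => ⟨B 0, hB 0 hj, hL'⟩, 0, one_pos, hL'⟩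
  · have := hm.pos
    have hc := hm.collective (by omega)
    refine (hF.transfer_collective hMN hc (i := ⟨j, hj⟩) hMj).mono (hF.equiv.refl N)
      subset_rfl ?_
    rintro L - ⟨hML, k', p', B', hc', hlt, hlt', heq⟩
    have hstep : ∀ D, ¬ F M D → ((∃ i : Fin k, F D (B i)) ↔ ∃ i, F D (B' i)) := by
      intro D hD
      have hne : cls F D ≠ cls F M := fun e => hD (hF.equiv.symm ((cls_eq_iff hF.equiv).1 e))
      have h1 := arrive_pos_iff hc (X := cls F D)
      have h2 := arrive_pos_iff hc' (X := cls F D)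
      have h3 := heq (cls F D) ⟨_, rfl⟩ hne
      have hpos : 0 < 1 - arrive (fun i : Fin k => p i) (fun i => B i) (cls F M) := by linarith
      have hpos' : 0 < 1 - arrive p' B' (cls F M) := by linarith
      have h4 : 0 < arrive (fun i : Fin k => p i) (fun i => B i) (cls F D)
          ↔ 0 < arrive p' B' (cls F D) := by
        rw [← mul_pos_iff_of_pos_right hpos', h3, mul_pos_iff_of_pos_right hpos]
      exact h1.symm.trans (h4.trans h2)
    obtain ⟨p'', B'', hm', -, hB''⟩ := hc'.exists_epsMove
    refine ⟨k', p'', B'', hm', fun i hi => ?_, ?_⟩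
    · have hi' : B'' i = B' ⟨i, hi⟩ := hB'' ⟨i, hi⟩
      rw [hi']
      by_cases hMi : F M (B' ⟨i, hi⟩)
      · exact ⟨M, hM, hMi⟩
      · obtain ⟨i₀, h₀⟩ := (hstep _ hMi).2 ⟨_, hF.equiv.refl _⟩
        exact ⟨B i₀, hB i₀ i₀.2, hF.equiv.symm h₀⟩
    · obtain ⟨i', h'⟩ := (hstep _ hMj).1 ⟨⟨j, hj⟩, hF.equiv.refl _⟩
      exact ⟨i', i'.2, (hB'' i').symm ▸ h'⟩

theorem cls_subset_saturation (hF : Equivalence F) {V : Set (Proc 𝒜)} {M N : Proc 𝒜}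
    (hM : M ∈ V) (hMN : F M N) : cls F N ⊆ saturation F V :=
  fun _ h => ⟨M, hM, hF.trans hMN h⟩

/-! ### Simulation of weak transitions, divergence and silent paths -/

/-- The saturation of `W` is the witness for `B`; it stays in the `E`-class because `F ⊆ E`. -/
theorem AlmostSure.transfer (hF : IsBranchingBisim F) {E : Proc 𝒜 → Proc 𝒜 → Prop}
    (hE : Equivalence E) (hFE : ∀ M N, F M N → E M N) {P : Proc 𝒜 → Prop} {A B : Proc 𝒜}
    (hAB : F A B) (hP : ∀ M N, E A M → F M N → P M → CanReach (cls F N) P N)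
    (h : AlmostSure E P A) : AlmostSure E P B := by
  obtain ⟨W, hW, hA, hR⟩ := h
  refine ⟨saturation F W, ?_, ⟨A, hA, hAB⟩, ?_⟩
  · rintro N ⟨M, hM, hMN⟩
    exact hE.trans (hE.symm (hFE _ _ hAB)) (hE.trans (hW hM) (hFE _ _ hMN))
  · rintro N ⟨M, hM, hMN⟩
    have hMR := hR M hM
    induction hMR generalizing N with
    | leaf h =>
      exact (hP _ N (hW hM) hMN h).mono (hF.equiv.refl N)
        (cls_subset_saturation hF.equiv hM hMN) fun _ _ h => h
    | @move M k p B j hm hB hj _ ih =>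
      -- A step within the `F`-class needs no answer, since `N` is already related to its target.
      by_cases hMj : F M (B j)
      · exact ih N (hB j hj) (hF.equiv.trans (hF.equiv.symm hMj) hMN)
      · refine ((hF.transfer_move hM hMN hm hB hj hMj).mono (hF.equiv.refl N)
          (cls_subset_saturation hF.equiv hM hMN) fun _ _ h => h).bind ?_
        rintro L ⟨k', p', B', hm', hB', j', hj', hjj'⟩
        exact .move hm' hB' hj' (ih _ (hB j hj) hjj')

/-- This is where explicit divergence is indispensable: when the moves in `V` may stay forever in
one class, simulation alone would let `N` answer by doing nothing. -/
theorem IsBranchingBisimED.canStay_saturation (hF : IsBranchingBisimED F) {V : Set (Proc 𝒜)}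
    (hV : ∀ M ∈ V, CanStay V M) : ∀ N ∈ saturation F V, CanStay (saturation F V) N := by
  rintro N ⟨M, hM, hMN⟩
  have hsub := cls_subset_saturation hF.1.equiv hM hMN
  -- Either one can stay forever in this part of the class, which makes `M` and hence `N` divergent,
  -- or some related `M'` has a move into `V` that leaves the class, and `N` has to answer it.
  by_cases hstay : ∀ M' ∈ V ∩ cls F M, CanStay (V ∩ cls F M) M'
  · have hdiv : Diverges F M := diverges_of_set Set.inter_subset_right ⟨hM, hF.1.equiv.refl M⟩ hstay
    obtain ⟨W, hW, hN, hWs⟩ := ((hF.2 M N hMN).1 hdiv).exists_set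
    exact (hWs N hN).mono (hW.trans hsub)
  · push Not at hstay
    obtain ⟨M', ⟨hM', hMM'⟩, hno⟩ := hstay
    have hMN' : F M' N := hF.1.equiv.trans (hF.1.equiv.symm hMM') hMN
    obtain ⟨k, p, B, hm, hB⟩ := hV M' hM'
    obtain ⟨j, hj, hMj⟩ : ∃ j < k, ¬ F M' (B j) := by
      by_contra! hall
      exact hno ⟨k, p, B, hm, fun i hi => ⟨hB i hi, hF.1.equiv.trans hMM' (hall i hi)⟩⟩
    rcases (hF.1.transfer_move hM' hMN' hm hB hj hMj).or_canStay with h | h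
    · obtain ⟨k', p', B', hm', hB', -⟩ := h
      exact ⟨k', p', B', hm', hB'⟩
    · exact h.mono hsub

theorem IsBranchingBisim.transfer_silentReach (hF : IsBranchingBisim F) {A A' B : Proc 𝒜}
    (h : SilentReach A A') (hAB : F A B) : ∃ B', SilentReach B B' ∧ F A' B' := by
  induction h with
  | refl => exact ⟨B, .refl, hAB⟩
  | @tail M M' _ hs ih =>
    obtain ⟨N, hBN, hMN⟩ := ih
    by_cases hMM' : F M M'
    · exact ⟨N, hBN, hF.equiv.trans (hF.equiv.symm hMM') hMN⟩
    · obtain ⟨l, hl, hs⟩ := hs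
      obtain ⟨k, p, U, hm, j, hj, rfl⟩ := exists_epsMove_of_silent hl hs
      obtain ⟨L, hNL, k', p', B', hm', -, j', hj', hjj'⟩ := (hF.transfer_move (V := Set.univ)
        (Set.mem_univ M) hMN hm (fun _ _ => Set.mem_univ _) hj hMM').exists_silentReach
      exact ⟨B' j', (hBN.trans hNL).tail (hm'.exists_silent hj'), hjj'⟩

/-- `C` and the complement of the `E`-class of `M` are unions of exit classes of `F`. Their
probabilities change by the same factor, which cancels in the quotient. -/
theorem QLeaf.transfer (hF : IsBranchingBisim F) {E : Proc 𝒜 → Proc 𝒜 → Prop}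
    (hE : Equivalence E) (hFE : ∀ M N, F M N → E M N) {q : ℝ} {C : Set (Proc 𝒜)}
    (hC : C ∈ classes E) {M N : Proc 𝒜} (hCM : C ≠ cls E M) (hMN : F M N) (h : QLeaf E q C M) :
    CanReach (cls F N) (QLeaf E q C) N := by
  obtain ⟨k, p, B, hc, hlt, hq⟩ := h
  obtain ⟨i, hi⟩ := (arrive_lt_one_iff hc).1 hlt
  refine (hF.transfer_collective hMN hc fun h => hi (hFE _ _ h)).mono (hF.equiv.refl N)
    subset_rfl ?_
  rintro L - ⟨hML, k', p', B', hc', hltF, hltF', heq⟩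
  have hcls : cls E L = cls E M := (cls_eq_iff hE).2 (hE.symm (hFE _ _ hML))
  obtain ⟨D, rfl⟩ := hC
  have h1 := arrive_saturated hF.equiv heq (X := cls E D)
    (fun N N' h h' => hE.trans h' (hFE _ _ h)) fun h => hCM ((cls_eq_iff hE).2 h)
  have h2 := arrive_saturated hF.equiv heq (X := (cls E M)ᶜ)
    (fun N N' h h' h'' => h' (hE.trans h'' (hE.symm (hFE _ _ h)))) fun h => h (hE.refl M)
  rw [arrive_compl hc, arrive_compl hc'] at h2
  have hx : 0 < 1 - arrive p B (cls E M) := by linarith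
  have hc0 : 0 < 1 - arrive p B (cls F M) := by linarith
  have hc0' : 0 < 1 - arrive p' B' (cls F M) := by linarith
  have hx' : 0 < 1 - arrive p' B' (cls E M) := by
    have := mul_pos hx hc0'
    rw [h2] at this
    exact (mul_pos_iff_of_pos_right hc0).1 this
  refine ⟨k', p', B', hc', by rw [hcls]; linarith, ?_⟩
  rw [hcls, ← hq, div_eq_div_iff hx'.ne' hx.ne']
  -- Both sides carry the product of the two positive `F`-exit probabilities, so that `h1` and `h2`
  -- combine without division; it is cancelled afterwards.
  have : (arrive p' B' (cls E D) * (1 - arrive p B (cls E M))) *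
      ((1 - arrive p B (cls F M)) * (1 - arrive p' B' (cls F M))) =
      (arrive p B (cls E D) * (1 - arrive p' B' (cls E M))) *
      ((1 - arrive p B (cls F M)) * (1 - arrive p' B' (cls F M))) := by
    linear_combination (-(1 - arrive p B (cls E M)) * (1 - arrive p' B' (cls F M))) * h1 +
      arrive p B (cls E D) * (1 - arrive p' B' (cls F M)) * h2
  exact mul_right_cancel₀ (mul_pos hc0 hc0').ne' this

theorem EllLeaf.transfer (hF : IsBranchingBisim F) {E : Proc 𝒜 → Proc 𝒜 → Prop}
    (hE : Equivalence E) (hFE : ∀ M N, F M N → E M N) {l : Act 𝒜} {C : Set (Proc 𝒜)}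
    (hC : C ∈ classes E) {M N : Proc 𝒜} (hl : (∃ a, l = .ext a) ∨ (l = .tau ∧ C ≠ cls E M))
    (hMN : F M N) (h : EllLeaf l C M) : CanReach (cls F N) (EllLeaf l C) N := by
  obtain ⟨M', hM', hs⟩ := h
  obtain ⟨D, rfl⟩ := hC
  refine (hF.transfer_act hMN hs (hl.imp id fun h => ⟨h.1, fun hMM' =>
    h.2 ((cls_eq_iff hE).2 (hE.trans hM' (hE.symm (hFE _ _ hMM'))))⟩)).mono
    (hF.equiv.refl N) subset_rfl ?_
  rintro L - ⟨L', hL', hs'⟩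
  exact ⟨L', hE.trans hM' (hFE _ _ hL'), hs'⟩

theorem EllTrans.transfer (hF : IsBranchingBisim F) {E : Proc 𝒜 → Proc 𝒜 → Prop}
    (hE : Equivalence E) (hFE : ∀ M N, F M N → E M N) {A B : Proc 𝒜} (hAB : F A B) {l : Act 𝒜}
    {C : Set (Proc 𝒜)} (h : EllTrans E A l C) : EllTrans E B l C := by
  have hcls : cls E A = cls E B := (cls_eq_iff hE).2 (hFE _ _ hAB)
  obtain ⟨hC, hl, h⟩ := ellTrans_iff.1 h
  refine ellTrans_iff.2 ⟨hC, hcls ▸ hl, h.transfer hF hE hFE hAB fun M N hAM hMN hM => ?_⟩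
  rw [(cls_eq_iff hE).2 hAM] at hl
  exact hM.transfer hF hE hFE hC hl hMN

theorem QTrans.transfer (hF : IsBranchingBisim F) {E : Proc 𝒜 → Proc 𝒜 → Prop}
    (hE : Equivalence E) (hFE : ∀ M N, F M N → E M N) {A B : Proc 𝒜} (hAB : F A B) {q : ℝ}
    {C : Set (Proc 𝒜)} (h : QTrans E A q C) : QTrans E B q C := by
  have hcls : cls E A = cls E B := (cls_eq_iff hE).2 (hFE _ _ hAB)
  obtain ⟨hC, hCA, h⟩ := qTrans_iff.1 h
  refine qTrans_iff.2 ⟨hC, hcls ▸ hCA, h.transfer hF hE hFE hAB fun M N hAM hMN hM => ?_⟩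
  rw [(cls_eq_iff hE).2 hAM] at hCA
  exact hM.transfer hF hE hFE hC hCA hMN

theorem Diverges.transfer (hF : IsBranchingBisimED F) {E : Proc 𝒜 → Proc 𝒜 → Prop}
    (hE : Equivalence E) (hFE : ∀ M N, F M N → E M N) {A B : Proc 𝒜} (hAB : F A B)
    (h : Diverges E A) : Diverges E B := by
  obtain ⟨W, hW, hA, hWs⟩ := h.exists_set
  refine diverges_of_set (W := saturation F W) ?_ ⟨A, hA, hAB⟩ (hF.canStay_saturation hWs)
  rintro N ⟨M, hM, hMN⟩
  exact hE.trans (hE.symm (hFE _ _ hAB)) (hE.trans (hW hM) (hFE _ _ hMN))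

end Transfer

/-! ### Bisimilarity is a bisimulation -/

theorem isBranchingBisimED_eq : IsBranchingBisimED (𝒜 := 𝒜) Eq :=
  ⟨⟨eq_equivalence, by rintro A _ rfl C _ l h; exact h, by rintro A _ rfl C _ q h; exact h⟩,
    by rintro A _ rfl; exact Iff.rfl⟩

/-- Each link of a chain lies in some bisimulation `F` contained in this closure, so the invariance
results for coarser equivalences apply link by link. -/
theorem isBranchingBisimED_transGen :
    IsBranchingBisimED (Relation.TransGen (BisimilarED (𝒜 := 𝒜))) := by
  have hsymm : ∀ {A B : Proc 𝒜}, BisimilarED A B → BisimilarED B A := by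
    rintro A B ⟨F, hF, h⟩
    exact ⟨F, hF, hF.1.equiv.symm h⟩
  have hE : Equivalence (Relation.TransGen (BisimilarED (𝒜 := 𝒜))) := by
    refine ⟨fun A => .single ⟨Eq, isBranchingBisimED_eq, rfl⟩, fun h => ?_, fun h h' => h.trans h'⟩
    induction h with
    | single h => exact .single (hsymm h)
    | tail _ h ih => exact .head (hsymm h) ih
  have hdiv : ∀ A B : Proc 𝒜, Relation.TransGen BisimilarED A B →
      Diverges (Relation.TransGen BisimilarED) A → Diverges (Relation.TransGen BisimilarED) B := by
    intro A B hAB h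
    induction hAB with
    | single hAB =>
      obtain ⟨F, hF, hAB⟩ := hAB
      exact h.transfer hF hE (fun _ _ h => .single ⟨F, hF, h⟩) hAB
    | tail _ hBC ih =>
      obtain ⟨F, hF, hBC⟩ := hBC
      exact ih.transfer hF hE (fun _ _ h => .single ⟨F, hF, h⟩) hBC
  refine ⟨⟨hE, fun A B hAB C _ l h => ?_, fun A B hAB C _ q h => ?_⟩,
    fun A B hAB => ⟨hdiv A B hAB, hdiv B A (hE.symm hAB)⟩⟩
  · induction hAB with
    | single hAB =>
      obtain ⟨F, hF, hAB⟩ := hAB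
      exact h.transfer hF.1 hE (fun _ _ h => .single ⟨F, hF, h⟩) hAB
    | tail _ hBC ih =>
      obtain ⟨F, hF, hBC⟩ := hBC
      exact ih.transfer hF.1 hE (fun _ _ h => .single ⟨F, hF, h⟩) hBC
  · induction hAB with
    | single hAB =>
      obtain ⟨F, hF, hAB⟩ := hAB
      exact h.transfer hF.1 hE (fun _ _ h => .single ⟨F, hF, h⟩) hAB
    | tail _ hBC ih =>
      obtain ⟨F, hF, hBC⟩ := hBC
      exact ih.transfer hF.1 hE (fun _ _ h => .single ⟨F, hF, h⟩) hBC

theorem isBranchingBisimED_bisimilarED : IsBranchingBisimED (BisimilarED (𝒜 := 𝒜)) := by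
  have : Relation.TransGen (BisimilarED (𝒜 := 𝒜)) = BisimilarED := by
    funext A B
    exact propext ⟨fun h => ⟨_, isBranchingBisimED_transGen, h⟩, fun h => .single h⟩
  rw [← this]
  exact isBranchingBisimED_transGen

/-! ### Invariance of end components -/

theorem IsTauEC.canStay {G : Graph 𝒜} (hG : IsTauEC G) : ∀ M ∈ G.verts, CanStay G.verts M := by
  obtain ⟨B, hG⟩ := hG
  intro M hM
  obtain ⟨⟨C, l, D⟩, he⟩ := hG.nonempty
  -- A path from `M` to the source of a given edge starts with an edge at `M`, or is empty and then
  -- the given edge starts at `M`.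
  have hout : ∃ l D, (M, l, D) ∈ G.edges := by
    rcases (hG.connected M hM C (hG.edge C l D he).1).cases_head with rfl | ⟨D', ⟨l', h⟩, -⟩
    · exact ⟨l, D, he⟩
    · exact ⟨l', D', h⟩
  obtain ⟨l, D, he⟩ := hout
  obtain ⟨-, hD, hs⟩ := hG.edge M l D he
  rcases hG.silent M l D he with rfl | ⟨r, -, -, rfl⟩
  · exact ⟨1, _, _, .of_tau hs, fun _ _ => hD⟩
  · obtain ⟨n, p, U, hc, -, hall⟩ := hG.closed M r D he
    obtain ⟨p', U', hm, -, hU⟩ := hc.exists_epsMove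
    refine ⟨n, p', U', hm, fun i hi => ?_⟩
    rw [hU ⟨i, hi⟩]
    exact (hG.edge _ _ _ (hall ⟨i, hi⟩)).2.1

/-- The silent transitions inside `W` which belong to a move into `W`. -/
inductive StayEdge (W : Set (Proc 𝒜)) : Proc 𝒜 → Label 𝒜 → Proc 𝒜 → Prop
  | tau {C D : Proc 𝒜} : D ∈ W → Step C (.act .tau) D → StayEdge W C (.act .tau) D
  | prob {C : Proc 𝒜} {n : ℕ} {p : Fin n → ℝ} {D : Fin n → Proc 𝒜} (i : Fin n) :
      Collective C n p D → (∀ i, D i ∈ W) → StayEdge W C (.prob (p i)) (D i)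

theorem StayEdge.mem {W : Set (Proc 𝒜)} {C D : Proc 𝒜} {l : Label 𝒜} (h : StayEdge W C l D) :
    D ∈ W := by
  cases h with
  | tau h _ => exact h
  | prob i _ h => exact h i

theorem StayEdge.step {W : Set (Proc 𝒜)} {C D : Proc 𝒜} {l : Label 𝒜} (h : StayEdge W C l D) :
    IsSilent l ∧ Step C l D := by
  cases h with
  | tau _ h => exact ⟨.inl rfl, h⟩
  | prob i h _ => exact ⟨.inr ⟨_, h.pos i, h.lt_one i, rfl⟩, Term.Collective.step h i⟩

theorem CanStay.exists_stayEdge {W : Set (Proc 𝒜)} {C : Proc 𝒜} (h : CanStay W C) :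
    ∃ l D, StayEdge W C l D := by
  obtain ⟨k, p, B, hm, hB⟩ := h
  have := hm.pos
  by_cases h1 : k = 1
  · exact ⟨_, _, .tau (hB 0 this) (hm.tau h1).1⟩
  · exact ⟨_, _, .prob ⟨0, this⟩ (hm.collective (by omega)) fun i => hB i i.2⟩

/-- A bottom strongly connected component of the graph of stay edges, which exists by finiteness,
contains every stay edge leaving its nodes. It therefore contains all branches of its probabilistic
choices. -/
theorem exists_tauEC {W : Set (Proc 𝒜)} (hW : ∀ M ∈ W, CanStay W M) {B : Proc 𝒜} (hB : B ∈ W) :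
    ∃ G : Graph 𝒜, IsTauEC G ∧ ReachesEC B G ∧ G.verts ⊆ W := by
  set r : Proc 𝒜 → Proc 𝒜 → Prop := Relation.ReflTransGen fun C D => ∃ l, StayEdge W C l D
  have hreach : ∀ {C D}, r C D → SilentReach C D := fun h =>
    Relation.ReflTransGen.mono (fun _ _ ⟨l, hl⟩ => ⟨l, hl.step⟩) _ _ h
  have hsilent : ∀ {C D : Proc 𝒜}, SilentReach C D → Reachable C D := fun h =>
    Relation.ReflTransGen.mono (fun _ _ ⟨l, hl⟩ => ⟨l, hl.2⟩) _ _ h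
  have hmem : ∀ {C D}, C ∈ W → r C D → D ∈ W := by
    intro C D hC h
    rcases h.cases_tail with rfl | ⟨_, _, l, hl⟩
    exacts [hC, hl.mem]
  have hfin : ∀ C, {D | r C D}.Finite := fun C =>
    (finite_reachable C).subset fun D h => hsilent (hreach h)
  -- A process with the fewest reachable processes lies in a bottom component: nothing reachable
  -- from it reaches fewer, so everything reachable from it leads back to it.
  obtain ⟨N, hBN, hmin⟩ := (hfin B).exists_minimalFor (fun C => {D | r C D}.ncard) _ ⟨B, .refl⟩
  have hback : ∀ {C}, r N C → r C N := by
    intro C h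
    have hsub : {D | r C D} ⊆ {D | r N D} := fun D h' => h.trans h'
    have hcard := hmin (show C ∈ {D | r B D} from hBN.trans h) (Set.ncard_le_ncard hsub (hfin N))
    have heq := Set.eq_of_subset_of_ncard_le hsub hcard (hfin N)
    have : N ∈ {D | r N D} := Relation.ReflTransGen.refl
    rwa [← heq] at this
  have hNW : N ∈ W := hmem hB hBN
  refine ⟨⟨{C | r N C}, {e | r N e.1 ∧ StayEdge W e.1 e.2.1 e.2.2}⟩, ⟨N, ?_⟩,
    ⟨N, hreach hBN, Relation.ReflTransGen.refl⟩, fun C h => hmem hNW h⟩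
  refine ⟨fun C h => hsilent (hreach h), ?_, ?_, ?_, fun C l D h => h.2.step.1, ?_⟩
  · rintro C l D ⟨h1, h2⟩
    exact ⟨h1, h1.tail ⟨l, h2⟩, h2.step.2⟩
  -- A bottom component might be a single node; that it has an edge is guaranteed by `CanStay`.
  · obtain ⟨l, D, h⟩ := (hW N hNW).exists_stayEdge
    exact ⟨(N, l, D), .refl, h⟩
  · intro C hC D hD
    have hCD : r C D := (hback hC).trans hD
    clear hD
    induction hCD with
    | refl => exact .refl
    | tail h1 h2 ih =>
      obtain ⟨l, hl⟩ := h2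
      exact ih.tail ⟨l, hC.trans h1, hl⟩
  · rintro C q C' ⟨h1, h2⟩
    change StayEdge W C (.prob q) C' at h2
    cases h2 with
    | prob i hc hD => exact ⟨_, _, _, hc, ⟨i, rfl, rfl⟩, fun j => ⟨h1, .prob j hc hD⟩⟩

/-- The silent path to the component is simulated first; its end lies in the saturation of the node
set, where a new component is found. -/
theorem IsBranchingBisimED.transfer_tauEC {F : Proc 𝒜 → Proc 𝒜 → Prop}
    (hF : IsBranchingBisimED F) {A B : Proc 𝒜} (hAB : F A B) {G : Graph 𝒜} (hG : IsTauEC G)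
    (hA : ReachesEC A G) : ∃ G' : Graph 𝒜, IsTauEC G' ∧ ReachesEC B G' ∧ RelatedEC F G G' := by
  obtain ⟨A', hAA', hA'⟩ := hA
  obtain ⟨B', hBB', hAB'⟩ := hF.1.transfer_silentReach hAA' hAB
  obtain ⟨G', hG', ⟨N, hN, hNG⟩, hsub⟩ :=
    exists_tauEC (hF.canStay_saturation hG.canStay) ⟨A', hA', hAB'⟩
  exact ⟨G', hG', ⟨N, hBB'.trans hN, hNG⟩, fun C hC => hsub hC⟩

theorem IsBranchingBisimED.tauECInvariant {F : Proc 𝒜 → Proc 𝒜 → Prop}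
    (hF : IsBranchingBisimED F) : TauECInvariant F := by
  refine fun A B hAB => ⟨fun G hG hA => hF.transfer_tauEC hAB hG hA, fun G hG hB => ?_⟩
  obtain ⟨G', h1, h2, h3⟩ := hF.transfer_tauEC (hF.1.equiv.symm hAB) hG hB
  refine ⟨G', h1, h2, fun C hC => ?_⟩
  obtain ⟨D, hD, hDC⟩ := h3 C hC
  exact ⟨D, hD, hF.1.equiv.symm hDC⟩

end RCCS

end

theorem theorem3p12 (𝒜 : Type*) :
    RCCS.TauECInvariant (RCCS.BisimilarED (𝒜 := 𝒜)) ∧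
    RCCS.IsExhaustiveBranchingBisim (RCCS.BisimilarED (𝒜 := 𝒜)) ∧
    ∀ A B : RCCS.Proc 𝒜, RCCS.BisimilarED A B → RCCS.ExhaustiveBisimilar A B := by
  have h := RCCS.isBranchingBisimED_bisimilarED (𝒜 := 𝒜)
  exact ⟨h.tauECInvariant, ⟨h.1, h.tauECInvariant⟩, fun A B hAB =>
    ⟨_, ⟨h.1, h.tauECInvariant⟩, hAB⟩⟩
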